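/- Let $\hat\theta,m,c,k>0$ with $\left(\frac{c}{2m}\right)^2-\frac{k}{m}<0$. Consider on $\mathbb R^2$ the hybrid system with flow $\dot x=f(x)=\left(x_2,\,-\frac cm x_2-\frac km x_1\right)$ for $x\in C=\{x_1x_2\le 0\}\cup\{|x_1|\ge\hat\theta,\ x_1x_2\ge 0\}$ and jumps $x^+\in G(x)=\{(\hat\theta s,x_2): s\in\mathrm{SGN}(x_2)\}$ for $x\in D=\{x_1=0\}$, where $\mathrm{SGN}(v)=\{\operatorname{sign}(v)\}$ if $v\ne0$ and $\mathrm{SGN}(0)=\{1,-1\}$. Let $C_0=\{|x_1|=\hat\theta,\ x_1x_2\ge0\}\cup\{|x_1|\le\hat\theta,\ x_2=0\}$. For $x\in C$ let $(x_{1b},x_{2b})$ be the point at which the flow in $C$ from $x$ in backward time meets $C_0$, let $(x_{1f},x_{2f})$ be the point at which the flow in $C$ from $x$ in forward time meets $D$, and put $T_b(x)=\frac12mx_{2b}^2$, $T_f(x)=\frac12mx_{2f}^2$. Then these two points exist and are unique for every $x\in C$, and the set $$A=\{x\in C: T_b(x)=T_f(x),\ x\neq0\}$$ is nonempty and compact.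 Nontrivial hybrid periodic trajectories exist, and the image of each of them is exactly $A$. Here a solution is a hybrid arc on a hybrid time domain starting in $\overline C\cup D$, flowing in $C$ and jumping from $D$; a hybrid periodic trajectory is a solution $x$ with unbounded domain for which there is $(T,J)$ with $T\ge0$, $J\in\mathbb Z_{>0}$, or $T>0$, $J\in\mathbb Z_{\ge0}$, such that $(t,j)\in\operatorname{dom}x$ implies $(t+T,j+J)\in\operatorname{dom}x$ and $x(t,j)=x(t+T,j+J)$; it is nontrivial if its image has more than one point. Moreover $A$ is asymptotically stable: for every $\varepsilon>0$ there is $\delta>0$ such that every solution starting within distance $\delta$ of $A$ stays within distance $\varepsilon$ of $A$, and all points in some neighbourhood of $A$ belong to the basin of attraction of $A$. The basin of attraction, that is, the set of points $\xi$ such that every solution from $\xi$ is bounded, every maximal solution from $\xi$ is complete (has unbounded domain), and every complete solution from $\xi$ satisfies $\operatorname{dist}(x(t,j),A)\to0$ as $t+j\to\infty$, is equal to $\mathbb R^2\setminus\{0\}$. (Points outside $\overline C\cup D$, from which there are no solutions, belong to it vacuously.) -/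

import Mathlib

open Set MeasureTheory

noncomputable section

/-! ### Hybrid systems: time domains, solutions, stability -/

/-- A hybrid system with data `(C, F, D, G)`: flow set, (set-valued) flow map, jump set,
(set-valued) jump map. -/
structure HybridSystem (E : Type*) where
  C : Set E
  F : E → Set E
  D : Set E
  G : E → Set E

/-- A compact hybrid time domain: `⋃_{j < N} [t j, t (j+1)] × {j}` for a finite sequence of times
`0 = t 0 ≤ t 1 ≤ ⋯ ≤ t N`. -/
def IsCompactHybridTimeDomain (S : Set (ℝ × ℕ)) : Prop :=
  ∃ (N : ℕ) (t : ℕ → ℝ), t 0 = 0 ∧ (∀ j < N, t j ≤ t (j + 1)) ∧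
    S = {p | p.2 < N ∧ p.1 ∈ Icc (t p.2) (t (p.2 + 1))}

/-- A hybrid time domain: a subset of `[0,∞) × ℕ` all of whose truncations at its own points are
compact hybrid time domains. -/
def IsHybridTimeDomain (S : Set (ℝ × ℕ)) : Prop :=
  (∀ p ∈ S, 0 ≤ p.1) ∧
    ∀ p ∈ S, IsCompactHybridTimeDomain (S ∩ (Icc 0 p.1 ×ˢ Iic p.2))

/-- A function of hybrid time `(t, j)` together with its domain. Values off `dom` are
irrelevant. -/
structure HybridTrajectory (E : Type*) where
  dom : Set (ℝ × ℕ)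
  val : ℝ → ℕ → E

namespace HybridTrajectory

variable {E : Type*}

/-- The times at which the trajectory is defined after exactly `j` jumps. -/
def interval (φ : HybridTrajectory E) (j : ℕ) : Set ℝ := {t | (t, j) ∈ φ.dom}

/-- The set of values attained on the domain. -/
def image (φ : HybridTrajectory E) : Set E := {x | ∃ p ∈ φ.dom, φ.val p.1 p.2 = x}

/-- Complete: the domain is unbounded. -/
def IsComplete (φ : HybridTrajectory E) : Prop :=
  ∀ N : ℝ, ∃ p ∈ φ.dom, N ≤ p.1 + p.2

end HybridTrajectory

namespace HybridSystem

variable {E : Type*} [NormedAddCommGroup E] [NormedSpace ℝ E]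

/-- Solutions of a hybrid system: hybrid arcs (hybrid time domain, locally absolutely continuous
in `t` for every `j`) that start in `closure C ∪ D`, flow in `C` along `F` and jump from `D`
according to `G`. -/
structure IsSolution (H : HybridSystem E) (φ : HybridTrajectory E) : Prop where
  domain : IsHybridTimeDomain φ.dom
  zero_mem : (0, 0) ∈ φ.dom
  absCont : ∀ (j : ℕ) (a b : ℝ), a ≤ b → Icc a b ⊆ φ.interval j →
    AbsolutelyContinuousOnInterval (fun t => φ.val t j) a b
  init : φ.val 0 0 ∈ closure H.C ∪ H.D
  flow_mem : ∀ j, ∀ t ∈ interior (φ.interval j), φ.val t j ∈ H.C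
  flow_deriv : ∀ j, ∀ᵐ t : ℝ, t ∈ interior (φ.interval j) →
    ∃ v ∈ H.F (φ.val t j), HasDerivAt (fun s => φ.val s j) v t
  jump : ∀ t j, (t, j) ∈ φ.dom → (t, j + 1) ∈ φ.dom →
    φ.val t j ∈ H.D ∧ φ.val t (j + 1) ∈ H.G (φ.val t j)

/-- Maximal solutions: those that cannot be extended to a solution on a larger domain. -/
def IsMaximalSolution (H : HybridSystem E) (φ : HybridTrajectory E) : Prop :=
  H.IsSolution φ ∧
    ¬ ∃ ψ : HybridTrajectory E, H.IsSolution ψ ∧ φ.dom ⊂ ψ.dom ∧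
      ∀ p ∈ φ.dom, ψ.val p.1 p.2 = φ.val p.1 p.2

/-- Hybrid periodic trajectories: complete solutions that are invariant under a shift `(T, J)` of
hybrid time, where `T ≥ 0` and `J > 0`, or `T > 0` and `J ≥ 0`. -/
def IsPeriodicTrajectory (H : HybridSystem E) (φ : HybridTrajectory E) : Prop :=
  H.IsSolution φ ∧ φ.IsComplete ∧
    ∃ (T : ℝ) (J : ℕ), ((0 ≤ T ∧ 0 < J) ∨ (0 < T ∧ 0 ≤ J)) ∧
      ∀ t j, (t, j) ∈ φ.dom → (t + T, j + J) ∈ φ.dom ∧ φ.val t j = φ.val (t + T) (j + J)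

/-- A periodic trajectory is nontrivial if its image has more than one point. -/
def IsNontrivialPeriodicTrajectory (H : HybridSystem E) (φ : HybridTrajectory E) : Prop :=
  H.IsPeriodicTrajectory φ ∧ φ.image.Nontrivial

/-- `dist(φ(t,j), A) → 0` as `t + j → ∞` in the domain of `φ`. -/
def ConvergesTo (φ : HybridTrajectory E) (A : Set E) : Prop :=
  ∀ ε > 0, ∃ N : ℝ, ∀ p ∈ φ.dom, N ≤ p.1 + p.2 → Metric.infDist (φ.val p.1 p.2) A ≤ ε

/-- Stability of a (nonempty) set. -/
def IsStable (H : HybridSystem E) (A : Set E) : Prop :=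
  ∀ ε > 0, ∃ δ > 0, ∀ φ, H.IsSolution φ → Metric.infDist (φ.val 0 0) A ≤ δ →
    ∀ p ∈ φ.dom, Metric.infDist (φ.val p.1 p.2) A ≤ ε

/-- All solutions from `ξ` are bounded, all maximal ones are complete, and the complete ones
converge to `A`. Vacuous for points from which there is no solution, i.e. points outside
`closure C ∪ D`. -/
def IsAttractedTo (H : HybridSystem E) (A : Set E) (ξ : E) : Prop :=
  ∀ φ, H.IsSolution φ → φ.val 0 0 = ξ →
    Bornology.IsBounded φ.image ∧ (H.IsMaximalSolution φ → φ.IsComplete) ∧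
      (φ.IsComplete → ConvergesTo φ A)

/-- Local attractivity of a (nonempty) set. -/
def IsAttractive (H : HybridSystem E) (A : Set E) : Prop :=
  ∃ μ > 0, ∀ ξ, Metric.infDist ξ A ≤ μ → H.IsAttractedTo A ξ

/-- Asymptotic stability of a (nonempty, compact) set: stability and local attractivity. -/
def IsAsymptoticallyStable (H : HybridSystem E) (A : Set E) : Prop :=
  H.IsStable A ∧ H.IsAttractive A

/-- The basin of attraction of a (nonempty, compact) set. -/
def basinOfAttraction (H : HybridSystem E) (A : Set E) : Set E :=
  {ξ | H.IsAttractedTo A ξ}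

end HybridSystem

/-! ### The mass-spring-damper system with resets -/

namespace ResetOscillator

/-- The phase plane with its Euclidean norm; coordinates `x 0` (position relative to the spring's
equilibrium) and `x 1` (velocity). -/
abbrev Plane := EuclideanSpace ℝ (Fin 2)

/-- The vector field `f(x) = (x₂, -(c/m) x₂ - (k/m) x₁)`. -/
def vectorField (m c k : ℝ) (x : Plane) : Plane :=
  !₂[x 1, -(c / m) * x 1 - (k / m) * x 0]

/-- The flow set. -/
def flowSet (θ : ℝ) : Set Plane :=
  {x | x 0 * x 1 ≤ 0} ∪ {x | θ ≤ |x 0| ∧ 0 ≤ x 0 * x 1}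

/-- The jump set. -/
def jumpSet : Set Plane := {x | x 0 = 0}

/-- The set-valued sign. -/
def setSign (v : ℝ) : Set ℝ := if v = 0 then {1, -1} else {Real.sign v}

/-- The set-valued jump map. -/
def jumpMap (θ : ℝ) (x : Plane) : Set Plane :=
  {y | ∃ s ∈ setSign (x 1), y = !₂[θ * s, x 1]}

/-- The hybrid system. -/
def system (m c k θ : ℝ) : HybridSystem Plane where
  C := flowSet θ
  F := fun x => {vectorField m c k x}
  D := jumpSet
  G := jumpMap θ

/-- The curve `C₀` at which flows in the flow set begin. -/
def initialCurve (θ : ℝ) : Set Plane :=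
  {x | |x 0| = θ ∧ 0 ≤ x 0 * x 1} ∪ {x | |x 0| ≤ θ ∧ x 1 = 0}

/-- `z` is, on `[0, τ]`, an integral curve of the vector field that stays in the flow set. -/
def IsFlowArc (m c k θ : ℝ) (z : ℝ → Plane) (τ : ℝ) : Prop :=
  ∀ t ∈ Icc 0 τ, HasDerivWithinAt z (vectorField m c k (z t)) (Icc 0 τ) t ∧ z t ∈ flowSet θ

/-- `y` is the point where the flow from `x` in backward time first meets `C₀`. -/
def IsBackwardPoint (m c k θ : ℝ) (x y : Plane) : Prop :=
  ∃ (τ : ℝ) (z : ℝ → Plane), 0 ≤ τ ∧ IsFlowArc m c k θ z τ ∧ z τ = x ∧ z 0 = y ∧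
    y ∈ initialCurve θ ∧ ∀ s ∈ Ioc 0 τ, z s ∉ initialCurve θ

/-- `y` is the point where the flow from `x` in forward time first meets the jump set. -/
def IsForwardPoint (m c k θ : ℝ) (x y : Plane) : Prop :=
  ∃ (τ : ℝ) (z : ℝ → Plane), 0 ≤ τ ∧ IsFlowArc m c k θ z τ ∧ z 0 = x ∧ z τ = y ∧
    y ∈ jumpSet ∧ ∀ s ∈ Ico 0 τ, z s ∉ jumpSet

/-- The point `(x_{1b}, x_{2b})`. -/
def backwardPoint (m c k θ : ℝ) (x : Plane) : Plane :=
  Classical.epsilon (IsBackwardPoint m c k θ x)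

/-- The point `(x_{1f}, x_{2f})`. -/
def forwardPoint (m c k θ : ℝ) (x : Plane) : Plane :=
  Classical.epsilon (IsForwardPoint m c k θ x)

/-- The backward kinetic energy `T_b`. -/
def backwardKinetic (m c k θ : ℝ) (x : Plane) : ℝ :=
  1 / 2 * m * (backwardPoint m c k θ x 1) ^ 2

/-- The forward kinetic energy `T_f`. -/
def forwardKinetic (m c k θ : ℝ) (x : Plane) : ℝ :=
  1 / 2 * m * (forwardPoint m c k θ x 1) ^ 2

/-- The set `A = {x ∈ C : T_b(x) = T_f(x), x ≠ 0}`. -/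
def attractor (m c k θ : ℝ) : Set Plane :=
  {x | x ∈ flowSet θ ∧ backwardKinetic m c k θ x = forwardKinetic m c k θ x ∧ x ≠ 0}

end ResetOscillator

end

open Filter Topology

/-! Write `a = c/(2m)` and `ω² = k/m - a² > 0`. The complex coordinate `w = -x₂ - (a - iω) x₁` turns
the free flow into `w' = -(a + iω) w`. Writing `w = p e^{aβ/ω} e^{iβ}`, the amplitude `p` is
constant along the flow and the phase `β` falls at rate `ω`. Every nonzero point of the flow set is,
up to the symmetry `x ↦ -x`, given by unique parameters `p > 0` and `β ∈ [0, π)`. The flow from it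
reaches `D` at phase `0`, in the point `(0, -p)`. Beyond phase `0` the motion leaves the flow set at
once.

The jump sends `(0, -p)` to `-(θ, p)`. By symmetry, the dynamics reduce to iterating the half-turn
map `v ↦ p`, where `(θ, v)` has amplitude `p`. Parametrised by the phase `β` of `(θ, v)`, with `g =
cos + (a/ω) sin`, it reads `v² = (ωθ)² (g(β)/sin β)²`, `p² = (ωθ)² e^{-2aβ/ω}/sin² β`. The
derivatives in `β` differ only by the factor `e^{-2aβ/ω}`. For `v ≥ 0` the phase exceeds `π/2`, so
the map contracts squared velocities by `e^{-aπ/ω} < 1` (`IsHalfTurn.abs_sq_sub_sq_le`). A fixed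
amplitude `p₀` comes from the intermediate value theorem, and the contraction makes it unique.

The condition `T_b = T_f` says exactly that the amplitude is `p₀` (`spiral_mem_attractor_iff`), so
`A` consists of one compact spiral arc and its negative. Every solution from a nonzero point is a
restriction of one explicit complete solution (`IsTurnSequence.solution_eq`), along which `|p_j² -
p₀²|` decays geometrically. Compactness translates amplitude error into distance to `A` and back,
which gives stability and attraction. Periodicity forces the amplitude error to vanish. The origin
is excluded from the basin because a solution can rest there. -/

namespace ResetOscillator

/-! ### Spiral coordinates: amplitude and phase. -/

/-- Up to a negative factor, the velocity of the free oscillation at phase `β` before it crosses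
`x 0 = 0` downwards. -/
noncomputable def velocityShape (a ω β : ℝ) : ℝ := Real.cos β + a / ω * Real.sin β

/-- The point at phase `β` before the downward crossing of `x 0 = 0` on the free orbit that crosses
it at `(0, -p)`. -/
noncomputable def spiral (a ω p β : ℝ) : Plane :=
  !₂[p * (Real.exp (a / ω * β) * Real.sin β) / ω,
    -(p * Real.exp (a / ω * β) * velocityShape a ω β)]

/-- The part of the flow set from which the free flow crosses `x 0 = 0` downwards. -/
def rightSet (θ : ℝ) : Set Plane := {x | x ∈ flowSet θ ∧ 0 ≤ x 0 ∧ (0 < x 0 ∨ x 1 < 0)}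

variable {a ω θ p β : ℝ}

@[simp] lemma spiral_zero_coord :
    spiral a ω p β 0 = p * (Real.exp (a / ω * β) * Real.sin β) / ω := by simp [spiral]

@[simp] lemma spiral_one_coord :
    spiral a ω p β 1 = -(p * Real.exp (a / ω * β) * velocityShape a ω β) := by simp [spiral]

lemma plane_ext {x y : Plane} (h0 : x 0 = y 0) (h1 : x 1 = y 1) : x = y := by
  ext i; fin_cases i <;> assumption

lemma spiral_zero_phase : spiral a ω p 0 = !₂[0, -p] := by
  apply plane_ext <;> simp [velocityShape]

lemma continuous_coord (i : Fin 2) : Continuous fun x : Plane => x i := by fun_prop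

lemma velocityShape_zero : velocityShape a ω 0 = 1 := by simp [velocityShape]

lemma velocityShape_pi : velocityShape a ω Real.pi = -1 := by simp [velocityShape]

lemma continuous_velocityShape : Continuous (velocityShape a ω) := by
  unfold velocityShape; fun_prop

/-- The quotient of the shape by `sin` is `cot + a/ω`, which is decreasing. The identity used is
this fact cleared of denominators, so that `β' = π` is allowed. -/
lemma velocityShape_neg_of_lt {β' : ℝ} (h0 : 0 < β) (hβ : velocityShape a ω β ≤ 0)
    (hlt : β < β') (hπ : β' ≤ Real.pi) : velocityShape a ω β' < 0 := by
  have hs : 0 < Real.sin β := Real.sin_pos_of_pos_of_lt_pi h0 (by linarith)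
  have hs' : 0 ≤ Real.sin β' := Real.sin_nonneg_of_nonneg_of_le_pi (by linarith) hπ
  have hd : 0 < Real.sin (β' - β) := Real.sin_pos_of_pos_of_lt_pi (by linarith) (by linarith)
  rw [Real.sin_sub] at hd
  have : Real.sin β * velocityShape a ω β' =
      Real.sin β' * velocityShape a ω β - (Real.sin β' * Real.cos β - Real.cos β' * Real.sin β) := by
    unfold velocityShape; ring
  have h2 : Real.sin β' * velocityShape a ω β ≤ 0 := mul_nonpos_of_nonneg_of_nonpos hs' hβ
  by_contra hcon
  have := mul_nonneg hs.le (not_lt.mp hcon)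
  linarith

lemma velocityShape_nonneg_of_le {β' : ℝ} (h0 : 0 ≤ β') (hβ : 0 ≤ velocityShape a ω β)
    (hle : β' ≤ β) (hπ : β ≤ Real.pi) : 0 ≤ velocityShape a ω β' := by
  rcases hle.eq_or_lt with rfl | hlt
  · exact hβ
  rcases h0.eq_or_lt with rfl | h0
  · rw [velocityShape_zero]; norm_num
  by_contra hcon
  have := velocityShape_neg_of_lt h0 (not_le.mp hcon).le hlt hπ
  linarith

lemma hasDerivAt_exp_mul_sin (ρ β : ℝ) :
    HasDerivAt (fun b => Real.exp (ρ * b) * Real.sin b)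
      (Real.exp (ρ * β) * (Real.cos β + ρ * Real.sin β)) β := by
  have h1 : HasDerivAt (fun b => Real.exp (ρ * b)) (Real.exp (ρ * β) * ρ) β := by
    simpa using ((hasDerivAt_id β).const_mul ρ).exp
  exact (h1.mul (Real.hasDerivAt_sin β)).congr_deriv (by ring)

/-- The derivative of the position in the phase is a positive multiple of the shape, so once the
velocity is nonnegative the position falls when time runs backward. -/
lemma spiral_position_lt {β' : ℝ} (hω : 0 < ω) (hp : 0 < p) (h0 : 0 < β)
    (hβ : velocityShape a ω β ≤ 0) (hlt : β < β') (hπ : β' ≤ Real.pi) :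
    spiral a ω p β' 0 < spiral a ω p β 0 := by
  have hanti : StrictAntiOn (fun b => Real.exp (a / ω * b) * Real.sin b) (Icc β β') := by
    apply strictAntiOn_of_deriv_neg (convex_Icc _ _) (by fun_prop)
    intro b hb
    rw [interior_Icc] at hb
    rw [(hasDerivAt_exp_mul_sin (a / ω) b).deriv]
    exact mul_neg_of_pos_of_neg (Real.exp_pos _)
      (velocityShape_neg_of_lt h0 hβ hb.1 (hb.2.le.trans hπ))
  have := hanti (left_mem_Icc.2 hlt.le) (right_mem_Icc.2 hlt.le) hlt
  simp only [spiral_zero_coord]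
  gcongr

lemma spiral_position_pos (hω : 0 < ω) (hp : 0 < p) (h0 : 0 < β) (hπ : β < Real.pi) :
    0 < spiral a ω p β 0 := by
  have := Real.sin_pos_of_pos_of_lt_pi h0 hπ
  rw [spiral_zero_coord]; positivity

lemma spiral_velocity_nonneg_iff (hp : 0 < p) :
    0 ≤ spiral a ω p β 1 ↔ velocityShape a ω β ≤ 0 := by
  have : 0 < p * Real.exp (a / ω * β) := by positivity
  rw [spiral_one_coord, neg_nonneg]
  exact ⟨fun h => by by_contra hc; nlinarith [mul_pos this (not_le.mp hc)],
    fun h => mul_nonpos_of_nonneg_of_nonpos this.le h⟩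

lemma spiral_velocity_nonpos_iff (hp : 0 < p) :
    spiral a ω p β 1 ≤ 0 ↔ 0 ≤ velocityShape a ω β := by
  have : 0 < p * Real.exp (a / ω * β) := by positivity
  rw [spiral_one_coord, neg_nonpos]
  exact mul_nonneg_iff_of_pos_left this

/-! ### Central symmetry and the right half of the flow set. -/

lemma neg_mem_flowSet {x : Plane} : -x ∈ flowSet θ ↔ x ∈ flowSet θ := by
  simp [flowSet]

lemma neg_mem_jumpSet {x : Plane} : -x ∈ jumpSet ↔ x ∈ jumpSet := by
  simp [jumpSet]

lemma neg_mem_initialCurve {x : Plane} : -x ∈ initialCurve θ ↔ x ∈ initialCurve θ := by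
  simp [initialCurve]

lemma mem_flowSet_of_position_eq_zero {x : Plane} (h : x 0 = 0) : x ∈ flowSet θ := by
  left; simp [h]

lemma initialCurve_subset_flowSet : initialCurve θ ⊆ flowSet θ := by
  rintro x (⟨h1, h2⟩ | ⟨-, h2⟩)
  · exact Or.inr ⟨h1.ge, h2⟩
  · left; simp [h2]

lemma isClosed_flowSet : IsClosed (flowSet θ) := by
  have h0 := continuous_coord 0
  have h1 := continuous_coord 1
  exact (isClosed_le (h0.mul h1) continuous_const).union
    ((isClosed_le continuous_const h0.abs).inter (isClosed_le continuous_const (h0.mul h1)))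

lemma mem_rightSet_or_neg_mem {x : Plane} (hx : x ∈ flowSet θ) (h0 : x ≠ 0) :
    x ∈ rightSet θ ∨ -x ∈ rightSet θ := by
  have key : x 0 ≠ 0 ∨ x 1 ≠ 0 := by
    by_contra! h
    exact h0 (plane_ext h.1 h.2)
  simp only [rightSet, mem_ofPred_eq, neg_mem_flowSet, hx, true_and, PiLp.neg_apply]
  rcases lt_trichotomy (x 0) 0 with h | h | h
  · right; exact ⟨by linarith, Or.inl (by linarith)⟩
  · rcases lt_or_gt_of_ne (key.resolve_left (by simpa using h)) with h' | h'
    · left; exact ⟨h.ge, Or.inr h'⟩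
    · right; exact ⟨by linarith, Or.inr (by linarith)⟩
  · left; exact ⟨h.le, Or.inl h⟩

lemma neg_notMem_rightSet {x : Plane} (hx : x ∈ rightSet θ) : -x ∉ rightSet θ := by
  rintro ⟨-, h1, h2⟩
  obtain ⟨-, h3, h4⟩ := hx
  simp only [PiLp.neg_apply] at h1 h2
  rcases h2 with h2 | h2 <;> rcases h4 with h4 | h4 <;> linarith

lemma ne_zero_of_mem_rightSet {x : Plane} (hx : x ∈ rightSet θ) : x ≠ 0 := by
  rintro rfl
  simp [rightSet] at hx

lemma spiral_mem_rightSet_iff (hω : 0 < ω) (hp : 0 < p) (h0 : 0 ≤ β) (hπ : β < Real.pi) :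
    spiral a ω p β ∈ rightSet θ ↔ 0 ≤ velocityShape a ω β ∨ θ ≤ spiral a ω p β 0 := by
  have hA := spiral_velocity_nonneg_iff (a := a) (ω := ω) (β := β) hp
  have hB := spiral_velocity_nonpos_iff (a := a) (ω := ω) (β := β) hp
  rcases h0.eq_or_lt with rfl | h0
  · refine iff_of_true ?_ (Or.inl (by simp [velocityShape_zero]))
    rw [spiral_zero_phase]
    exact ⟨Or.inl (by simp), by simp, Or.inr (by simpa using hp)⟩
  have h := spiral_position_pos (a := a) hω hp h0 hπ
  simp only [rightSet, flowSet, mem_ofPred_eq, mem_union, abs_of_pos h, h, h.le, true_or,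
    and_true, ← hB]
  rw [mul_nonneg_iff_of_pos_left h, mul_nonpos_iff_pos_imp_nonpos]
  constructor
  · rintro (⟨h1, -⟩ | h1)
    · exact Or.inl (h1 h)
    · exact Or.inr h1.1
  · rintro (h1 | h1)
    · exact Or.inl ⟨fun _ => h1, fun _ => h.le⟩
    · rcases le_total (spiral a ω p β 1) 0 with h2 | h2
      · exact Or.inl ⟨fun _ => h2, fun _ => h.le⟩
      · exact Or.inr ⟨h1, h2⟩

lemma spiral_mem_rightSet_of_le {β' : ℝ} (hω : 0 < ω) (hp : 0 < p) (h0 : 0 ≤ β') (hle : β' ≤ β)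
    (hπ : β < Real.pi) (h : spiral a ω p β ∈ rightSet θ) : spiral a ω p β' ∈ rightSet θ := by
  rw [spiral_mem_rightSet_iff hω hp (by linarith) hπ] at h
  rw [spiral_mem_rightSet_iff hω hp h0 (by linarith)]
  rcases h with h | h
  · exact Or.inl (velocityShape_nonneg_of_le h0 h hle hπ.le)
  · by_cases h' : 0 ≤ velocityShape a ω β'
    · exact Or.inl h'
    right
    rcases hle.eq_or_lt with rfl | hlt
    · exact h
    have h0' : 0 < β' := by
      rcases h0.eq_or_lt with rfl | h0
      · simp [velocityShape_zero] at h'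
      · exact h0
    exact h.trans (spiral_position_lt hω hp h0' (not_le.mp h').le hlt hπ.le).le

/-! ### The complex coordinate and uniqueness of amplitude and phase. -/

/-- The `ℝ`-linear coordinate in which the free oscillation is multiplication by
`exp (-(a + ω i) t)`. -/
noncomputable def phaseCoord (a ω : ℝ) : Plane →L[ℝ] ℂ :=
  -(Complex.ofRealCLM.comp (EuclideanSpace.proj (1 : Fin 2))) -
    ((a : ℂ) - ω * Complex.I) • Complex.ofRealCLM.comp (EuclideanSpace.proj (0 : Fin 2))

lemma phaseCoord_apply (x : Plane) :
    phaseCoord a ω x = -(x 1 : ℂ) - ((a : ℂ) - ω * Complex.I) * (x 0 : ℂ) := by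
  simp [phaseCoord]

lemma phaseCoord_re (x : Plane) : (phaseCoord a ω x).re = -x 1 - a * x 0 := by
  simp [phaseCoord_apply]

lemma phaseCoord_im (x : Plane) : (phaseCoord a ω x).im = ω * x 0 := by
  simp [phaseCoord_apply]

lemma phaseCoord_injective (hω : 0 < ω) : Function.Injective (phaseCoord a ω) := by
  intro x y h
  have h1 := congrArg Complex.im h
  have h2 := congrArg Complex.re h
  rw [phaseCoord_im, phaseCoord_im] at h1
  rw [phaseCoord_re, phaseCoord_re] at h2
  have h3 := mul_left_cancel₀ hω.ne' h1
  rw [h3] at h2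
  exact plane_ext h3 (by linarith)

lemma phaseCoord_spiral (hω : 0 < ω) :
    phaseCoord a ω (spiral a ω p β) =
      ((p * Real.exp (a / ω * β) : ℝ) : ℂ) * (Complex.cos β + Complex.sin β * Complex.I) := by
  have hω' := hω.ne'
  rw [← Complex.ofReal_cos, ← Complex.ofReal_sin]
  apply Complex.ext
  · rw [phaseCoord_re, spiral_zero_coord, spiral_one_coord, velocityShape]
    simp only [Complex.mul_re, Complex.add_re, Complex.add_im, Complex.ofReal_re,
      Complex.ofReal_im, Complex.I_re, Complex.I_im, Complex.mul_im]
    field_simp; ring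
  · rw [phaseCoord_im, spiral_zero_coord]
    simp only [Complex.mul_im, Complex.add_re, Complex.add_im, Complex.ofReal_re,
      Complex.ofReal_im, Complex.I_re, Complex.I_im, Complex.mul_re]
    field_simp; ring

/-- The phase is the argument of the complex coordinate, which lies in `[0, π)` exactly on this half
plane; the amplitude is the modulus with the factor `e^{aβ/ω}` removed. -/
lemma exists_eq_spiral (hω : 0 < ω) {x : Plane} (h0 : 0 ≤ x 0) (h1 : 0 < x 0 ∨ x 1 < 0) :
    ∃ p β, 0 < p ∧ 0 ≤ β ∧ β < Real.pi ∧ x = spiral a ω p β := by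
  set w := phaseCoord a ω x with hw
  have hw0 : w ≠ 0 := by
    intro h
    have h2 : w.im = ω * x 0 := phaseCoord_im x
    have h3 : w.re = -x 1 - a * x 0 := phaseCoord_re x
    rw [h] at h2 h3
    have h4 : x 0 = 0 := by simpa [hω.ne'] using h2.symm
    rw [h4] at h3 h1
    rcases h1 with h1 | h1
    · exact h1.ne rfl
    · simp at h3; linarith
  have harg : 0 ≤ w.arg := by
    rw [Complex.arg_nonneg_iff, phaseCoord_im]; positivity
  refine ⟨‖w‖ * Real.exp (-(a / ω * w.arg)), w.arg, by positivity, harg, ?_, ?_⟩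
  · refine lt_of_le_of_ne (Complex.arg_le_pi w) fun h => ?_
    rw [Complex.arg_eq_pi_iff, phaseCoord_im, phaseCoord_re] at h
    have h4 : x 0 = 0 := by simpa [hω.ne'] using h.2
    rw [h4] at h h1
    rcases h1 with h1 | h1
    · exact h1.ne rfl
    · linarith [h.1]
  · apply phaseCoord_injective (a := a) hω
    rw [phaseCoord_spiral hω, mul_assoc, ← Real.exp_add]
    simp [Complex.norm_mul_cos_add_sin_mul_I, ← hw]

lemma exists_eq_spiral_of_mem_rightSet (hω : 0 < ω) {x : Plane} (hx : x ∈ rightSet θ) :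
    ∃ p β, 0 < p ∧ 0 ≤ β ∧ β < Real.pi ∧ x = spiral a ω p β :=
  exists_eq_spiral hω hx.2.1 hx.2.2

lemma spiral_inj {p' β' : ℝ} (hω : 0 < ω) (hp : 0 < p) (hp' : 0 < p') (h0 : 0 ≤ β)
    (hπ : β < Real.pi) (h0' : 0 ≤ β') (hπ' : β' < Real.pi)
    (h : spiral a ω p β = spiral a ω p' β') : p = p' ∧ β = β' := by
  have h1 := congrArg (phaseCoord a ω) h
  rw [phaseCoord_spiral hω, phaseCoord_spiral hω] at h1
  have hβ : β = β' := by
    have h2 := congrArg Complex.arg h1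
    rwa [Complex.arg_mul_cos_add_sin_mul_I (by positivity) ⟨by linarith, hπ.le⟩,
      Complex.arg_mul_cos_add_sin_mul_I (by positivity) ⟨by linarith, hπ'.le⟩] at h2
  subst hβ
  have h3 := congrArg (fun z => ‖z‖) h1
  simp only [norm_mul, Complex.norm_cos_add_sin_mul_I, mul_one, Complex.norm_real,
    Real.norm_eq_abs, Real.abs_exp, abs_of_pos hp, abs_of_pos hp'] at h3
  exact ⟨mul_right_cancel₀ (Real.exp_pos _).ne' h3, rfl⟩

lemma norm_phaseCoord_spiral (hω : 0 < ω) (hp : 0 ≤ p) :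
    ‖phaseCoord a ω (spiral a ω p β)‖ = p * Real.exp (a / ω * β) := by
  rw [phaseCoord_spiral hω, norm_mul, Complex.norm_cos_add_sin_mul_I, Complex.norm_real,
    Real.norm_eq_abs, abs_of_nonneg (by positivity), mul_one]

lemma continuous_spiral : Continuous fun q : ℝ × ℝ => spiral a ω q.1 q.2 := by
  have h : Continuous fun q : ℝ × ℝ => velocityShape a ω q.2 :=
    continuous_velocityShape.comp continuous_snd
  refine (PiLp.continuous_toLp 2 _).comp (continuous_pi fun i => ?_)
  fin_cases i
  · simp; fun_prop
  · simp; fun_prop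

/-- Just after the downward crossing both coordinates are negative while the position is still above
`-θ`, which is the region removed from the flow set. -/
lemma spiral_eventually_notMem_flowSet (hω : 0 < ω) (hθ : 0 < θ) (hp : 0 < p) :
    ∀ᶠ s in 𝓝[>] (0 : ℝ), spiral a ω p (-s) ∉ flowSet θ := by
  have hc : Continuous fun s : ℝ => spiral a ω p (-s) :=
    continuous_spiral.comp (continuous_const.prodMk continuous_neg)
  have hc0 : Continuous fun s : ℝ => spiral a ω p (-s) 0 := (continuous_coord 0).comp hc
  have hc1 : Continuous fun s : ℝ => spiral a ω p (-s) 1 := (continuous_coord 1).comp hc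
  have e0 : ∀ᶠ s in 𝓝[>] (0 : ℝ), -θ < spiral a ω p (-s) 0 := by
    refine (hc0.tendsto 0).mono_left nhdsWithin_le_nhds |>.eventually (lt_mem_nhds ?_)
    simpa using hθ
  have e1 : ∀ᶠ s in 𝓝[>] (0 : ℝ), spiral a ω p (-s) 1 < 0 := by
    refine (hc1.tendsto 0).mono_left nhdsWithin_le_nhds |>.eventually (gt_mem_nhds ?_)
    simpa [velocityShape] using hp
  have e2 : ∀ᶠ s in 𝓝[>] (0 : ℝ), s < Real.pi :=
    (tendsto_id.mono_left nhdsWithin_le_nhds).eventually (gt_mem_nhds Real.pi_pos)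
  filter_upwards [e0, e1, e2, self_mem_nhdsWithin] with s h0 h1 h2 h3
  have hs := Real.sin_pos_of_pos_of_lt_pi h3 h2
  have hneg : spiral a ω p (-s) 0 < 0 := by
    rw [spiral_zero_coord, Real.sin_neg]
    have : 0 < p * (Real.exp (a / ω * -s) * Real.sin s) / ω := by positivity
    have e : p * (Real.exp (a / ω * -s) * -Real.sin s) / ω =
      -(p * (Real.exp (a / ω * -s) * Real.sin s) / ω) := by ring
    linarith
  rintro (h | ⟨h, -⟩)
  · simp only [mem_ofPred_eq] at h
    linarith [mul_pos_of_neg_of_neg hneg h1]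
  · rw [abs_of_neg hneg] at h; linarith

/-! ### The meeting point of a spiral with `C₀`. -/

lemma spiral_mem_initialCurve_iff (hω : 0 < ω) (hθ : 0 < θ) (hp : 0 < p) (h0 : 0 ≤ β)
    (hπ : β < Real.pi) :
    spiral a ω p β ∈ initialCurve θ ↔ velocityShape a ω β ≤ 0 ∧ spiral a ω p β 0 ≤ θ ∧
      (spiral a ω p β 0 = θ ∨ velocityShape a ω β = 0) := by
  have hA := spiral_velocity_nonneg_iff (a := a) (ω := ω) (β := β) hp
  have hB := spiral_velocity_nonpos_iff (a := a) (ω := ω) (β := β) hp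
  rcases h0.eq_or_lt with rfl | h0
  · refine iff_of_false ?_ (by simp [velocityShape_zero])
    rw [spiral_zero_phase]
    rintro (⟨h, -⟩ | ⟨-, h⟩)
    · simp [hθ.ne] at h
    · simp [hp.ne'] at h
  have h := spiral_position_pos (a := a) hω hp h0 hπ
  have hC : spiral a ω p β 1 = 0 ↔ velocityShape a ω β = 0 := by
    rw [le_antisymm_iff, hA, hB, le_antisymm_iff, and_comm]
  simp only [initialCurve, mem_union, mem_ofPred_eq, abs_of_pos h, mul_nonneg_iff_of_pos_left h,
    hA, hC]
  constructor
  · rintro (h1 | h1)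
    · exact ⟨h1.2, h1.1.le, Or.inl h1.1⟩
    · exact ⟨h1.2.le, h1.1, Or.inr h1.2⟩
  · rintro ⟨h1, h2, h3 | h3⟩
    · exact Or.inl ⟨h3, h1⟩
    · exact Or.inr ⟨h2, h3⟩

/-- At phases beyond a meeting with `C₀` the position is strictly below `θ` and the velocity
strictly positive, so neither branch of `C₀` can be met again. -/
lemma initialCurve_phase_unique {β' : ℝ} (hω : 0 < ω) (hθ : 0 < θ) (hp : 0 < p) (h0 : 0 ≤ β)
    (hπ : β < Real.pi) (h0' : 0 ≤ β') (hπ' : β' < Real.pi)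
    (h : spiral a ω p β ∈ initialCurve θ) (h' : spiral a ω p β' ∈ initialCurve θ) : β = β' := by
  wlog hle : β ≤ β' generalizing β β'
  · exact (this h0' hπ' h0 hπ h' h (not_le.mp hle).le).symm
  rw [spiral_mem_initialCurve_iff hω hθ hp h0 hπ] at h
  rw [spiral_mem_initialCurve_iff hω hθ hp h0' hπ'] at h'
  by_contra hne
  have hlt := lt_of_le_of_ne hle hne
  have hpos : 0 < β := by
    rcases h0.eq_or_lt with rfl | h0
    · have := h.1; rw [velocityShape_zero] at this; linarith
    · exact h0
  have h1 := spiral_position_lt hω hp hpos h.1 hlt hπ'.le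
  have h2 := velocityShape_neg_of_lt hpos h.1 hlt hπ'.le
  rcases h'.2.2 with h3 | h3
  · linarith [h.2.1]
  · linarith

lemma exists_initial_phase (hω : 0 < ω) (hθ : 0 < θ) (hp : 0 < p) (h0 : 0 ≤ β)
    (hπ : β < Real.pi) (h : spiral a ω p β ∈ rightSet θ) :
    ∃ β', β ≤ β' ∧ β' < Real.pi ∧ spiral a ω p β' ∈ initialCurve θ ∧
      spiral a ω p β' ∈ rightSet θ := by
  wlog hv : velocityShape a ω β ≤ 0 generalizing β
  -- If the velocity is negative, go back to the turning point, where it vanishes; it suffices to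
  -- treat that phase.
  · have hivt := intermediate_value_Icc' hπ.le
      (continuous_velocityShape (a := a) (ω := ω)).continuousOn
    obtain ⟨b, hb, hb0⟩ := hivt ⟨by rw [velocityShape_pi]; norm_num, (not_le.mp hv).le⟩
    have hbπ : b < Real.pi := lt_of_le_of_ne hb.2 fun e => by
      rw [e, velocityShape_pi] at hb0; norm_num at hb0
    have hb0' := h0.trans hb.1
    obtain ⟨β', h1, h2⟩ := this hb0' hbπ
      ((spiral_mem_rightSet_iff hω hp hb0' hbπ).2 (Or.inl hb0.ge)) hb0.le
    exact ⟨β', hb.1.trans h1, h2⟩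
  have hpos : 0 < β := by
    rcases h0.eq_or_lt with rfl | h0
    · rw [velocityShape_zero] at hv; linarith
    · exact h0
  rcases le_or_gt (spiral a ω p β 0) θ with hle | hgt
  · refine ⟨β, le_rfl, hπ, ?_, h⟩
    rw [spiral_mem_initialCurve_iff hω hθ hp h0 hπ]
    rw [spiral_mem_rightSet_iff hω hp h0 hπ] at h
    refine ⟨hv, hle, ?_⟩
    rcases h with h | h
    · exact Or.inr (le_antisymm hv h)
    · exact Or.inl (le_antisymm hle h)
  -- To the right of `θ`, go further back: the position falls to `0` at phase `π`, hence passes `θ`.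
  · have hc : ContinuousOn (fun b => spiral a ω p b 0) (Icc β Real.pi) := by
      simp only [spiral_zero_coord]; fun_prop
    obtain ⟨b, hb, hbθ⟩ := intermediate_value_Icc' hπ.le hc ⟨by simpa using hθ.le, hgt.le⟩
    simp only at hbθ
    have hbπ : b < Real.pi := lt_of_le_of_ne hb.2 fun e => by
      rw [e] at hbθ; simp at hbθ; linarith
    have hlt : β < b := lt_of_le_of_ne hb.1 fun e => by
      rw [e] at hgt; linarith
    have hb0 : 0 ≤ b := by linarith
    refine ⟨b, hb.1, hbπ, ?_, ?_⟩
    · rw [spiral_mem_initialCurve_iff hω hθ hp hb0 hbπ]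
      exact ⟨(velocityShape_neg_of_lt hpos hv hlt hbπ.le).le, hbθ.le, Or.inl hbθ⟩
    · rw [spiral_mem_rightSet_iff hω hp hb0 hbπ]
      exact Or.inr hbθ.ge

/-! ### The half-turn map, its contraction and its fixed point. -/

/-- `(θ, v)` is the point of phase `β` on the free orbit that next crosses `x 0 = 0` at
`(0, -p)`. -/
def IsHalfTurn (a ω θ v p β : ℝ) : Prop :=
  0 < p ∧ 0 < β ∧ β < Real.pi ∧ spiral a ω p β = !₂[θ, v]

lemma exists_isHalfTurn (hω : 0 < ω) (hθ : 0 < θ) (v : ℝ) : ∃ p β, IsHalfTurn a ω θ v p β := by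
  obtain ⟨p, β, hp, h0, hπ, h⟩ := exists_eq_spiral (a := a) hω (x := !₂[θ, v]) (by simpa using hθ.le)
    (Or.inl (by simpa using hθ))
  refine ⟨p, β, hp, lt_of_le_of_ne h0 ?_, hπ, h.symm⟩
  rintro rfl
  rw [spiral_zero_phase] at h
  have := congrArg (fun x : Plane => x 0) h
  simp at this; linarith

lemma IsHalfTurn.mem_rightSet {v : ℝ} (hω : 0 < ω) (h : IsHalfTurn a ω θ v p β) :
    spiral a ω p β ∈ rightSet θ := by
  obtain ⟨hp, h0, hπ, h⟩ := h
  rw [spiral_mem_rightSet_iff hω hp h0.le hπ]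
  right; rw [h]; simp

lemma IsHalfTurn.velocity_eq {v : ℝ} (hω : 0 < ω) (h : IsHalfTurn a ω θ v p β) :
    v = -(ω * θ * (velocityShape a ω β / Real.sin β)) ∧
      p ^ 2 = (ω * θ) ^ 2 * (Real.exp (-(2 * (a / ω) * β)) / Real.sin β ^ 2) := by
  obtain ⟨hp, h0, hπ, h⟩ := h
  have hs := Real.sin_pos_of_pos_of_lt_pi h0 hπ
  have e0 := congrArg (fun x : Plane => x 0) h
  have e1 := congrArg (fun x : Plane => x 1) h
  simp only [spiral_zero_coord, spiral_one_coord] at e0 e1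
  simp at e0 e1
  have hE := Real.exp_pos (a / ω * β)
  have hp' : p = ω * θ / (Real.exp (a / ω * β) * Real.sin β) := by
    field_simp at e0 ⊢; linarith
  constructor
  · rw [← e1, hp']; field_simp
  · have : Real.exp (-(2 * (a / ω) * β)) = (Real.exp (a / ω * β) ^ 2)⁻¹ := by
      rw [← Real.exp_nat_mul, ← Real.exp_neg]; congr 1; push_cast; ring
    rw [this, hp']; field_simp

lemma IsHalfTurn.shape_nonpos {v : ℝ} (hv : 0 ≤ v) (h : IsHalfTurn a ω θ v p β) :
    velocityShape a ω β ≤ 0 := by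
  obtain ⟨hp, h0, hπ, h⟩ := h
  rw [← spiral_velocity_nonneg_iff hp, h]
  simpa using hv

/-- On `(0, π/2]` the cosine is nonnegative and damping makes the sine term positive. This is the
source of the uniform contraction factor. -/
lemma half_pi_lt_of_shape_nonpos (ha : 0 < a) (hω : 0 < ω) (h0 : 0 < β) (hπ : β < Real.pi)
    (h : velocityShape a ω β ≤ 0) : Real.pi / 2 < β := by
  by_contra hle
  have hs := Real.sin_pos_of_pos_of_lt_pi h0 hπ
  have hc : 0 ≤ Real.cos β := Real.cos_nonneg_of_mem_Icc ⟨by linarith, not_lt.mp hle⟩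
  have : 0 < a / ω * Real.sin β := by positivity
  unfold velocityShape at h; linarith

lemma hasDerivAt_shape_div_sin_sq (hs : 0 < Real.sin β) :
    HasDerivAt (fun b => (velocityShape a ω b / Real.sin b) ^ 2)
      (-2 * velocityShape a ω β / Real.sin β ^ 3) β := by
  have h1 : HasDerivAt (velocityShape a ω) (-Real.sin β + a / ω * Real.cos β) β :=
    (Real.hasDerivAt_cos β).add ((Real.hasDerivAt_sin β).const_mul _)
  refine ((h1.div (Real.hasDerivAt_sin β) hs.ne').pow 2).congr_deriv ?_
  -- This numerator expresses `(cot + a/ω)' = -1/sin²`.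
  have h2 : (-Real.sin β + a / ω * Real.cos β) * Real.sin β - velocityShape a ω β * Real.cos β
      = -1 := by
    have := Real.sin_sq_add_cos_sq β
    unfold velocityShape; linear_combination -this
  simp only [h2, Pi.div_apply]
  field_simp
  norm_num
  field_simp

lemma hasDerivAt_exp_div_sin_sq (hs : 0 < Real.sin β) :
    HasDerivAt (fun b => Real.exp (-(2 * (a / ω) * b)) / Real.sin b ^ 2)
      (-2 * Real.exp (-(2 * (a / ω) * β)) * velocityShape a ω β / Real.sin β ^ 3) β := by
  have h1 : HasDerivAt (fun b => Real.exp (-(2 * (a / ω) * b)))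
      (Real.exp (-(2 * (a / ω) * β)) * -(2 * (a / ω))) β := by
    simpa using ((hasDerivAt_id β).const_mul (2 * (a / ω))).neg.exp
  refine (h1.div ((Real.hasDerivAt_sin β).pow 2) (pow_ne_zero 2 hs.ne')).congr_deriv ?_
  simp only [velocityShape, Pi.pow_apply]
  field_simp
  norm_num
  ring

/-- The half-turn map contracts squared velocities. -/
lemma IsHalfTurn.abs_sq_sub_sq_le {v v' p' β' : ℝ} (ha : 0 < a) (hω : 0 < ω) (hv : 0 ≤ v)
    (hv' : 0 ≤ v') (h : IsHalfTurn a ω θ v p β) (h' : IsHalfTurn a ω θ v' p' β') :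
    |p ^ 2 - p' ^ 2| ≤ Real.exp (-(a / ω * Real.pi)) * |v ^ 2 - v' ^ 2| := by
  wlog hle : β' ≤ β generalizing v p β v' p' β'
  · rw [abs_sub_comm, abs_sub_comm (v ^ 2)]
    exact this hv' hv h' h (not_le.mp hle).le
  have hsh := h'.shape_nonpos hv'
  obtain ⟨e1, e2⟩ := h.velocity_eq hω
  obtain ⟨e1', e2'⟩ := h'.velocity_eq hω
  obtain ⟨-, h0, hπ, -⟩ := h
  obtain ⟨-, h0', hπ', -⟩ := h'
  have hs : ∀ b ∈ Icc β' β, 0 < Real.sin b := fun b hb =>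
    Real.sin_pos_of_pos_of_lt_pi (by linarith [hb.1]) (by linarith [hb.2])
  have hshape : ∀ b ∈ Icc β' β, velocityShape a ω b ≤ 0 := fun b hb => by
    rcases hb.1.eq_or_lt with rfl | hlt
    · exact hsh
    · exact (velocityShape_neg_of_lt h0' hsh hlt (by linarith [hb.2])).le
  set q := Real.exp (-(a / ω * Real.pi)) with hq
  -- Up to the factor `(ωθ)²`, both `p²` and `q v² - p²` increase with the phase. The first settles
  -- the sign of the difference of the `p²`, the second bounds it.
  have hmono1 : MonotoneOn (fun b => Real.exp (-(2 * (a / ω) * b)) / Real.sin b ^ 2)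
      (Icc β' β) := by
    refine monotoneOn_of_deriv_nonneg (convex_Icc _ _)
      (fun b hb => (hasDerivAt_exp_div_sin_sq (hs b hb)).continuousAt.continuousWithinAt)
      (fun b hb => ?_) (fun b hb => ?_)
    · exact (hasDerivAt_exp_div_sin_sq
        (hs b (interior_subset hb))).differentiableAt.differentiableWithinAt
    · have hsb := hs b (interior_subset hb)
      rw [(hasDerivAt_exp_div_sin_sq hsb).deriv]
      apply div_nonneg _ (by positivity)
      have := mul_nonneg (Real.exp_pos (-(2 * (a / ω) * b))).le
        (neg_nonneg.2 (hshape b (interior_subset hb)))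
      linarith
  have hd : ∀ b ∈ Icc β' β, HasDerivAt (fun b => q * (velocityShape a ω b / Real.sin b) ^ 2 -
      Real.exp (-(2 * (a / ω) * b)) / Real.sin b ^ 2)
      (q * (-2 * velocityShape a ω b / Real.sin b ^ 3) -
        -2 * Real.exp (-(2 * (a / ω) * b)) * velocityShape a ω b / Real.sin b ^ 3) b := fun b hb =>
    ((hasDerivAt_shape_div_sin_sq (hs b hb)).const_mul q).sub
      (hasDerivAt_exp_div_sin_sq (hs b hb))
  have hmono2 : MonotoneOn (fun b => q * (velocityShape a ω b / Real.sin b) ^ 2 -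
      Real.exp (-(2 * (a / ω) * b)) / Real.sin b ^ 2) (Icc β' β) := by
    refine monotoneOn_of_deriv_nonneg (convex_Icc _ _)
      (fun b hb => (hd b hb).continuousAt.continuousWithinAt)
      (fun b hb => (hd b (interior_subset hb)).differentiableAt.differentiableWithinAt)
      (fun b hb => ?_)
    have hb' := interior_subset hb
    have hsb := hs b hb'
    rw [(hd b hb').deriv]
    have e : q * (-2 * velocityShape a ω b / Real.sin b ^ 3) -
        -2 * Real.exp (-(2 * (a / ω) * b)) * velocityShape a ω b / Real.sin b ^ 3 =
        2 * (q - Real.exp (-(2 * (a / ω) * b))) * (-velocityShape a ω b) / Real.sin b ^ 3 := by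
      ring
    rw [e]
    -- The ratio of the two derivatives is `e^{-2ab/ω}`, and `b > π/2`.
    have hq' : Real.exp (-(2 * (a / ω) * b)) ≤ q := by
      rw [hq, Real.exp_le_exp]
      have hb2 := half_pi_lt_of_shape_nonpos ha hω (by linarith [hb'.1]) (by linarith [hb'.2])
        (hshape b hb')
      have : 0 < a / ω := by positivity
      nlinarith
    have := hshape b hb'
    apply div_nonneg _ (by positivity)
    exact mul_nonneg (by linarith) (by linarith)
  have m1 := hmono1 (left_mem_Icc.2 hle) (right_mem_Icc.2 hle) hle
  have m2 := hmono2 (left_mem_Icc.2 hle) (right_mem_Icc.2 hle) hle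
  simp only at m1 m2
  have hp1 : 0 ≤ p ^ 2 - p' ^ 2 := by
    rw [e2, e2', ← mul_sub]
    exact mul_nonneg (sq_nonneg _) (by linarith)
  rw [abs_of_nonneg hp1]
  have hvv : p ^ 2 - p' ^ 2 ≤ q * (v ^ 2 - v' ^ 2) := by
    have hv2 : v ^ 2 = (ω * θ) ^ 2 * (velocityShape a ω β / Real.sin β) ^ 2 := by rw [e1]; ring
    have hv2' : v' ^ 2 = (ω * θ) ^ 2 * (velocityShape a ω β' / Real.sin β') ^ 2 := by
      rw [e1']; ring
    rw [e2, e2', hv2, hv2']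
    have := mul_nonneg (sq_nonneg (ω * θ)) (sub_nonneg.2 m2)
    linarith
  exact hvv.trans (mul_le_mul_of_nonneg_left (le_abs_self _) (Real.exp_pos _).le)

lemma exists_isHalfTurn_fixed (ha : 0 < a) (hω : 0 < ω) (hθ : 0 < θ) :
    ∃ p β, IsHalfTurn a ω θ p p β := by
  -- Velocity equal to amplitude means `-g(b) = e^{-ab/ω}`; the amplitude is then fixed by requiring
  -- position `θ`.
  have hc : ContinuousOn (fun b => -velocityShape a ω b - Real.exp (-(a / ω * b)))
      (Icc (Real.pi / 2) Real.pi) := by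
    have := continuous_velocityShape (a := a) (ω := ω)
    fun_prop
  have hπ := Real.pi_pos
  have hρ : 0 < a / ω := by positivity
  obtain ⟨b, hb, hb0⟩ := intermediate_value_Icc (by linarith : Real.pi / 2 ≤ Real.pi) hc
    (show (0 : ℝ) ∈ _ from ⟨by
      have := Real.exp_pos (-(a / ω * (Real.pi / 2)))
      simp only [velocityShape, Real.cos_pi_div_two, Real.sin_pi_div_two]
      linarith, by
      simp only [velocityShape_pi]
      have : Real.exp (-(a / ω * Real.pi)) ≤ 1 := Real.exp_le_one_iff.2 (by nlinarith)
      linarith⟩)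
  simp only at hb0
  have hbπ : b < Real.pi := lt_of_le_of_ne hb.2 fun e => by
    rw [e, velocityShape_pi] at hb0
    have : Real.exp (-(a / ω * Real.pi)) < 1 := Real.exp_lt_one_iff.2 (by nlinarith)
    linarith
  have hb1 : 0 < b := by linarith [hb.1]
  have hs := Real.sin_pos_of_pos_of_lt_pi hb1 hbπ
  have hE := Real.exp_pos (a / ω * b)
  refine ⟨ω * θ / (Real.exp (a / ω * b) * Real.sin b), b, by positivity, hb1, hbπ, ?_⟩
  have hv : velocityShape a ω b = -(Real.exp (a / ω * b))⁻¹ := by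
    rw [← Real.exp_neg]; linarith
  apply plane_ext
  · simp only [spiral_zero_coord]; simp; field_simp
  · simp only [spiral_one_coord, hv]; simp

end ResetOscillator

/-! ### Absolutely continuous curves. -/

lemma LipschitzWith.comp_absolutelyContinuousOnInterval {X Y : Type*} [PseudoMetricSpace X]
    [PseudoMetricSpace Y] {K : NNReal} {g : X → Y} (hg : LipschitzWith K g) {f : ℝ → X} {a b : ℝ}
    (hf : AbsolutelyContinuousOnInterval f a b) :
    AbsolutelyContinuousOnInterval (fun t => g (f t)) a b := by
  refine squeeze_zero (fun t => Finset.sum_nonneg fun i _ => dist_nonneg) (fun t => ?_)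
    (by simpa using Tendsto.const_mul (K : ℝ) hf)
  rw [Finset.mul_sum]
  gcongr
  exact hg.dist_le_mul _ _

lemma ContDiff.absolutelyContinuousOnInterval {E : Type*} [NormedAddCommGroup E]
    [NormedSpace ℝ E] {f : ℝ → E} (hf : ContDiff ℝ 1 f) (a b : ℝ) :
    AbsolutelyContinuousOnInterval f a b := by
  obtain ⟨K, hK⟩ := hf.contDiffOn.exists_lipschitzOnWith one_ne_zero (convex_uIcc a b)
    isCompact_uIcc
  exact hK.absolutelyContinuousOnInterval

lemma AbsolutelyContinuousOnInterval.of_hasDerivWithinAt {E : Type*} [NormedAddCommGroup E]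
    [NormedSpace ℝ E] {f f' : ℝ → E} {a b : ℝ} (hab : a ≤ b)
    (hf : ∀ t ∈ Icc a b, HasDerivWithinAt f (f' t) (Icc a b) t) (hf' : ContinuousOn f' (Icc a b)) :
    AbsolutelyContinuousOnInterval f a b := by
  obtain ⟨C, hC⟩ := isCompact_Icc.exists_bound_of_continuousOn hf'
  have : LipschitzOnWith C.toNNReal f (Icc a b) :=
    (convex_Icc a b).lipschitzOnWith_of_nnnorm_hasDerivWithin_le hf fun t ht => by
      rw [← NNReal.coe_le_coe, coe_nnnorm]
      exact (hC t ht).trans (Real.le_coe_toNNReal C)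
  rw [← uIcc_of_le hab] at this
  exact this.absolutelyContinuousOnInterval

/-! ### Free motion in spiral coordinates. -/

namespace ResetOscillator

/-- The parameters of the oscillator expressed through the decay rate `a` and the angular
frequency `ω` of its free motion. -/
structure Underdamped (m c k θ a ω : ℝ) : Prop where
  mass_pos : 0 < m
  threshold_pos : 0 < θ
  decay_pos : 0 < a
  freq_pos : 0 < ω
  damping_eq : c / m = 2 * a
  stiffness_eq : k / m = a ^ 2 + ω ^ 2

lemma exists_underdamped {m c k θ : ℝ} (hθ : 0 < θ) (hm : 0 < m) (hc : 0 < c)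
    (hroots : (c / (2 * m)) ^ 2 - k / m < 0) : ∃ a ω, Underdamped m c k θ a ω :=
  ⟨c / (2 * m), Real.sqrt (k / m - (c / (2 * m)) ^ 2), hm, hθ, by positivity,
    Real.sqrt_pos.2 (by linarith), by field_simp, by rw [Real.sq_sqrt (by linarith)]; ring⟩

variable {m c k θ a ω p β : ℝ}

lemma hasDerivAt_plane {f : ℝ → Plane} {f' : Plane} {t : ℝ}
    (h0 : HasDerivAt (fun s => f s 0) (f' 0) t) (h1 : HasDerivAt (fun s => f s 1) (f' 1) t) :
    HasDerivAt f f' t := by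
  rw [← hasDerivWithinAt_univ, hasDerivWithinAt_iff_hasFDerivWithinAt,
    hasFDerivWithinAt_euclidean]
  intro i
  fin_cases i
  · exact (h0.hasFDerivAt.congr_fderiv (by ext; simp)).hasFDerivWithinAt
  · exact (h1.hasFDerivAt.congr_fderiv (by ext; simp)).hasFDerivWithinAt

lemma vectorField_neg (x : Plane) : vectorField m c k (-x) = -vectorField m c k x := by
  apply plane_ext
  · simp [vectorField]
  · simp [vectorField]; ring

lemma continuous_vectorField : Continuous (vectorField m c k) := by
  have h0 := continuous_coord 0
  have h1 := continuous_coord 1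
  refine (PiLp.continuous_toLp 2 _).comp (continuous_pi fun i => ?_)
  fin_cases i
  · simpa using h1
  · simp; fun_prop

lemma phaseCoord_vectorField (h : Underdamped m c k θ a ω) (x : Plane) :
    phaseCoord a ω (vectorField m c k x) = -((a : ℂ) + ω * Complex.I) * phaseCoord a ω x := by
  apply Complex.ext
  · simp only [phaseCoord_re, vectorField, Complex.mul_re, Complex.neg_re, Complex.neg_im,
      phaseCoord_im, h.damping_eq, h.stiffness_eq]
    simp; ring
  · simp only [phaseCoord_re, vectorField, Complex.mul_im, Complex.neg_re, Complex.neg_im,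
      phaseCoord_im]
    simp; ring

/-- The free motion with phase `β` at time `s`, up to the sign `e`. -/
lemma hasDerivAt_spiral (h : Underdamped m c k θ a ω) (e p β s t : ℝ) :
    HasDerivAt (fun t => e • spiral a ω p (β - ω * (t - s)))
      (vectorField m c k (e • spiral a ω p (β - ω * (t - s)))) t := by
  have hω := h.freq_pos.ne'
  have hb : HasDerivAt (fun t => β - ω * (t - s)) (-ω) t := by
    simpa using (((hasDerivAt_id t).sub_const s).const_mul ω).const_sub β
  set b := β - ω * (t - s) with hbdef
  have h0 := (hasDerivAt_exp_mul_sin (a / ω) b).comp t hb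
  have h2 : HasDerivAt (velocityShape a ω) (-Real.sin b + a / ω * Real.cos b) b :=
    (Real.hasDerivAt_cos b).add ((Real.hasDerivAt_sin b).const_mul _)
  have h3 : HasDerivAt (fun b => Real.exp (a / ω * b)) (Real.exp (a / ω * b) * (a / ω)) b := by
    simpa using ((hasDerivAt_id b).const_mul (a / ω)).exp
  have h1 := (h3.mul h2).comp t hb
  apply hasDerivAt_plane
  · refine ((h0.const_mul (e * p / ω)).congr_of_eventuallyEq
      (Eventually.of_forall fun u => ?_)).congr_deriv ?_
    · simp; ring
    · simp [vectorField, velocityShape]; field_simp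
  · refine ((h1.const_mul (-(e * p))).congr_of_eventuallyEq
      (Eventually.of_forall fun u => ?_)).congr_deriv ?_
    · simp; ring
    · simp only [vectorField, h.damping_eq, h.stiffness_eq]
      simp [velocityShape]; field_simp; ring

lemma contDiff_spiral (e p β s : ℝ) : ContDiff ℝ 1 fun t => e • spiral a ω p (β - ω * (t - s)) := by
  apply ContDiff.const_smul
  rw [contDiff_euclidean]
  intro i
  fin_cases i
  · simp; fun_prop
  · simp [velocityShape]; fun_prop

/-- Integrating factor: multiplied by `e^{μ(u-s)}`, the coordinate is absolutely continuous with
derivative zero almost everywhere, hence constant. This covers solutions differentiable only almost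
everywhere. -/
lemma phaseCoord_free_motion (h : Underdamped m c k θ a ω) {z : ℝ → Plane} {s t : ℝ}
    (hst : s ≤ t) (hac : AbsolutelyContinuousOnInterval z s t)
    (hd : ∀ᵐ u : ℝ, u ∈ Ioo s t → HasDerivAt z (vectorField m c k (z u)) u) {u : ℝ}
    (hu : u ∈ Icc s t) :
    phaseCoord a ω (z u) =
      Complex.exp (-((a : ℂ) + ω * Complex.I) * ((u - s : ℝ) : ℂ)) * phaseCoord a ω (z s) := by
  set μ : ℂ := (a : ℂ) + ω * Complex.I with hμ
  have hE : ContDiff ℝ 1 fun u : ℝ => Complex.exp (μ * ((u - s : ℝ) : ℂ)) := by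
    apply ContDiff.cexp
    exact contDiff_const.mul (Complex.ofRealCLM.contDiff.comp (contDiff_id.sub contDiff_const))
  have hW : AbsolutelyContinuousOnInterval (fun u => phaseCoord a ω (z u)) s t :=
    (phaseCoord a ω).lipschitz.comp_absolutelyContinuousOnInterval hac
  have hac' := (hE.absolutelyContinuousOnInterval s t).fun_smul hW
  have hEd : ∀ u : ℝ, HasDerivAt (fun u : ℝ => Complex.exp (μ * ((u - s : ℝ) : ℂ)))
      (Complex.exp (μ * ((u - s : ℝ) : ℂ)) * μ) u := fun u => by
    have := (((hasDerivAt_id u).sub_const s).ofReal_comp.const_mul μ).cexp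
    simpa using this
  obtain ⟨C, hC⟩ := hac'.const_of_ae_hasDerivAt_zero (by
    -- The equation is known only on the open interval; the endpoints form a null set.
    have hs : ∀ᵐ u : ℝ, u ≠ s := by simp [ae_iff, measure_singleton]
    have ht : ∀ᵐ u : ℝ, u ≠ t := by simp [ae_iff, measure_singleton]
    filter_upwards [hd, hs, ht] with u hu hus hut huu
    rw [uIcc_of_le hst] at huu
    have hz := hu ⟨lt_of_le_of_ne huu.1 hus.symm, lt_of_le_of_ne huu.2 hut⟩
    have hz' := (phaseCoord a ω).hasFDerivAt.comp_hasDerivAt u hz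
    refine ((hEd u).smul hz').congr_deriv ?_
    simp only [Function.comp_apply, phaseCoord_vectorField h, smul_eq_mul, ← hμ]
    ring)
  rw [uIcc_of_le hst] at hC
  have h1 := (hC u hu).trans (hC s ⟨le_rfl, hst⟩).symm
  simp only [sub_self, Complex.ofReal_zero, mul_zero, Complex.exp_zero, smul_eq_mul, one_mul] at h1
  rw [← h1, ← mul_assoc, ← Complex.exp_add]
  simp

lemma eq_spiral_of_free_motion (h : Underdamped m c k θ a ω) {z : ℝ → Plane} {s t e : ℝ}
    (hst : s ≤ t) (hac : AbsolutelyContinuousOnInterval z s t)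
    (hd : ∀ᵐ u : ℝ, u ∈ Ioo s t → HasDerivAt z (vectorField m c k (z u)) u)
    (hz : z s = e • spiral a ω p β) {u : ℝ} (hu : u ∈ Icc s t) :
    z u = e • spiral a ω p (β - ω * (u - s)) := by
  apply phaseCoord_injective (a := a) h.freq_pos
  have h1 := phaseCoord_free_motion h hst hac hd hu
  have h2 := phaseCoord_free_motion h (z := fun t => e • spiral a ω p (β - ω * (t - s))) hst
    ((contDiff_spiral e p β s).absolutelyContinuousOnInterval s t)
    (Eventually.of_forall fun v _ => hasDerivAt_spiral h e p β s v) hu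
  rw [h1, h2, hz, sub_self, mul_zero, sub_zero]

lemma duration_le_of_mem_flowSet (h : Underdamped m c k θ a ω) {z : ℝ → Plane} {s t e : ℝ}
    (he : e = 1 ∨ e = -1) (hp : 0 < p) (hβ : 0 ≤ β)
    (hz : ∀ u ∈ Icc s t, z u = e • spiral a ω p (β - ω * (u - s)))
    (hC : ∀ u ∈ Ioo s t, z u ∈ flowSet θ) : ω * (t - s) ≤ β := by
  by_contra! hlt
  have hω := h.freq_pos
  have hsmall : ∀ᶠ r in 𝓝[>] (0 : ℝ), r < ω * (t - s) - β :=
    (tendsto_id.mono_left nhdsWithin_le_nhds).eventually (gt_mem_nhds (by simpa using hlt))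
  -- A phase overshoot `r` past the crossing, small enough to occur before time `t` and to lie
  -- outside the flow set.
  obtain ⟨r, h1, h2, h3⟩ := ((spiral_eventually_notMem_flowSet (a := a) hω h.threshold_pos
    hp).and (hsmall.and self_mem_nhdsWithin)).exists
  replace h3 : 0 < r := h3
  have hu : s + (β + r) / ω ∈ Ioo s t := by
    constructor
    · have : 0 < (β + r) / ω := by positivity
      linarith
    · have : (β + r) / ω < t - s := by rw [div_lt_iff₀ hω]; linarith
      linarith
  have h4 := hC _ hu
  rw [hz _ ⟨hu.1.le, hu.2.le⟩] at h4
  have e1 : β - ω * (s + (β + r) / ω - s) = -r := by field_simp; ring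
  rw [e1] at h4
  rcases he with rfl | rfl
  · exact h1 (by simpa using h4)
  · rw [neg_one_smul, neg_mem_flowSet] at h4
    exact h1 h4

lemma IsFlowArc.absolutelyContinuous {z : ℝ → Plane} {τ : ℝ} (hτ : 0 ≤ τ)
    (hz : IsFlowArc m c k θ z τ) : AbsolutelyContinuousOnInterval z 0 τ :=
  .of_hasDerivWithinAt hτ (fun t ht => (hz t ht).1)
    (continuous_vectorField.comp_continuousOn fun t ht => (hz t ht).1.continuousWithinAt)

lemma IsFlowArc.hasDerivAt {z : ℝ → Plane} {τ t : ℝ} (hz : IsFlowArc m c k θ z τ)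
    (ht : t ∈ Ioo 0 τ) : HasDerivAt z (vectorField m c k (z t)) t :=
  (hz t ⟨ht.1.le, ht.2.le⟩).1.hasDerivAt (Icc_mem_nhds ht.1 ht.2)

lemma IsFlowArc.eq_spiral (h : Underdamped m c k θ a ω) {z : ℝ → Plane} {τ e : ℝ} (hτ : 0 ≤ τ)
    (hz : IsFlowArc m c k θ z τ) (h0 : z 0 = e • spiral a ω p β) {t : ℝ} (ht : t ∈ Icc 0 τ) :
    z t = e • spiral a ω p (β - ω * t) := by
  simpa using eq_spiral_of_free_motion h hτ (hz.absolutelyContinuous hτ)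
    (Eventually.of_forall fun u hu => hz.hasDerivAt hu) h0 ht

lemma IsFlowArc.duration_le (h : Underdamped m c k θ a ω) {z : ℝ → Plane} {τ e : ℝ} (hτ : 0 ≤ τ)
    (hz : IsFlowArc m c k θ z τ) (he : e = 1 ∨ e = -1) (hp : 0 < p) (hβ : 0 ≤ β)
    (h0 : z 0 = e • spiral a ω p β) : ω * τ ≤ β := by
  simpa using duration_le_of_mem_flowSet h he hp hβ (z := z) (s := 0) (t := τ)
    (fun u hu => by simpa using hz.eq_spiral h hτ h0 hu)
    (fun u hu => (hz u ⟨hu.1.le, hu.2.le⟩).2)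

lemma isFlowArc_neg_iff {z : ℝ → Plane} {τ : ℝ} :
    IsFlowArc m c k θ (fun t => -z t) τ ↔ IsFlowArc m c k θ z τ := by
  have key : ∀ {z : ℝ → Plane}, IsFlowArc m c k θ z τ → IsFlowArc m c k θ (fun t => -z t) τ := by
    intro z hz t ht
    obtain ⟨h1, h2⟩ := hz t ht
    refine ⟨?_, neg_mem_flowSet.2 h2⟩
    simp only [vectorField_neg]
    exact h1.neg
  exact ⟨fun hz => by simpa using key hz, key⟩

lemma isFlowArc_spiral (h : Underdamped m c k θ a ω) (hp : 0 < p)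
    (hπ : β < Real.pi) (hR : spiral a ω p β ∈ rightSet θ) {τ : ℝ} (hτ : ω * τ ≤ β) :
    IsFlowArc m c k θ (fun t => spiral a ω p (β - ω * t)) τ := by
  intro t ht
  have hω := h.freq_pos
  have h1 : ω * t ≤ ω * τ := by gcongr; exact ht.2
  have h2 : 0 ≤ ω * t := mul_nonneg hω.le ht.1
  constructor
  · simpa using (hasDerivAt_spiral h 1 p β 0 t).hasDerivWithinAt
  · exact (spiral_mem_rightSet_of_le hω hp (by linarith) (by linarith) hπ hR).1

end ResetOscillator

/-! ### Forward and backward points. -/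

namespace ResetOscillator

variable {m c k θ a ω p β : ℝ}

lemma spiral_mem_jumpSet_iff (hω : 0 < ω) (hp : 0 < p) (h0 : 0 ≤ β) (hπ : β < Real.pi) :
    spiral a ω p β ∈ jumpSet ↔ β = 0 := by
  constructor
  · intro h
    by_contra hne
    exact (spiral_position_pos (a := a) hω hp (lt_of_le_of_ne h0 (Ne.symm hne)) hπ).ne' h
  · rintro rfl; simp [jumpSet]

lemma isForwardPoint_spiral_iff (h : Underdamped m c k θ a ω) (hp : 0 < p) (h0 : 0 ≤ β)
    (hπ : β < Real.pi) (hR : spiral a ω p β ∈ rightSet θ) {y : Plane} :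
    IsForwardPoint m c k θ (spiral a ω p β) y ↔ y = spiral a ω p 0 := by
  have hω := h.freq_pos
  constructor
  · rintro ⟨τ, z, hτ, hz, hz0, rfl, hy, -⟩
    have hz0' : z 0 = (1 : ℝ) • spiral a ω p β := by simpa using hz0
    have hle := hz.duration_le h hτ (Or.inl rfl) hp h0 hz0'
    have he := hz.eq_spiral h hτ hz0' (right_mem_Icc.2 hτ)
    rw [one_smul] at he
    have := mul_nonneg hω.le hτ
    rw [he, spiral_mem_jumpSet_iff hω hp (by linarith) (by linarith)] at hy
    rw [he, hy]
  · rintro rfl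
    have e : ω * (β / ω) = β := by field_simp
    refine ⟨β / ω, fun t => spiral a ω p (β - ω * t), by positivity,
      isFlowArc_spiral h hp hπ hR e.le, by simp, by simp [e],
      (spiral_mem_jumpSet_iff hω hp le_rfl Real.pi_pos).2 rfl, fun s hs => ?_⟩
    have h1 : ω * s < β := by
      rw [← e]; exact mul_lt_mul_of_pos_left hs.2 hω
    have h2 := mul_nonneg hω.le hs.1
    rw [spiral_mem_jumpSet_iff hω hp (by linarith) (by linarith)]
    linarith

lemma IsFlowArc.eq_zero_iff (h : Underdamped m c k θ a ω) {z : ℝ → Plane} {τ : ℝ} (hτ : 0 ≤ τ)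
    (hz : IsFlowArc m c k θ z τ) : z τ = 0 ↔ z 0 = 0 := by
  have h1 := phaseCoord_free_motion h hτ (hz.absolutelyContinuous hτ)
    (Eventually.of_forall fun u hu => hz.hasDerivAt hu) (right_mem_Icc.2 hτ)
  have h2 := phaseCoord_injective (a := a) h.freq_pos
  rw [← map_eq_zero_iff _ h2, h1, ← map_eq_zero_iff (phaseCoord a ω) h2 (x := z 0)]
  simp [Complex.exp_ne_zero]

lemma isBackwardPoint_spiral_iff (h : Underdamped m c k θ a ω) (hp : 0 < p) (h0 : 0 ≤ β)
    (hπ : β < Real.pi) (hR : spiral a ω p β ∈ rightSet θ) {y : Plane} :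
    IsBackwardPoint m c k θ (spiral a ω p β) y ↔
      ∃ β', β ≤ β' ∧ β' < Real.pi ∧ spiral a ω p β' ∈ initialCurve θ ∧ y = spiral a ω p β' := by
  have hω := h.freq_pos
  constructor
  · rintro ⟨τ, z, hτ, hz, hzτ, rfl, hy, -⟩
    have hy0 : z 0 ≠ 0 := by
      rw [Ne, ← hz.eq_zero_iff h hτ, hzτ]
      exact ne_zero_of_mem_rightSet hR
    have hyC := initialCurve_subset_flowSet hy
    have h2 := mul_nonneg hω.le hτ
    rcases mem_rightSet_or_neg_mem hyC hy0 with hr | hr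
    · obtain ⟨p', β', hp', h0', hπ', e⟩ := exists_eq_spiral_of_mem_rightSet (a := a) hω hr
      have e1 : z 0 = (1 : ℝ) • spiral a ω p' β' := by rw [e, one_smul]
      have hle := hz.duration_le h hτ (Or.inl rfl) hp' h0' e1
      have he := hz.eq_spiral h hτ e1 (right_mem_Icc.2 hτ)
      rw [one_smul, hzτ] at he
      obtain ⟨rfl, rfl⟩ := spiral_inj hω hp hp' h0 hπ (by linarith) (by linarith) he
      exact ⟨β', by linarith, hπ', e ▸ hy, e⟩
    -- A start in the left half is impossible: within the flow set the motion stays in that half up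
    -- to time `τ`.
    · exfalso
      obtain ⟨p', β', hp', h0', hπ', e⟩ := exists_eq_spiral_of_mem_rightSet (a := a) hω hr
      have e1 : z 0 = (-1 : ℝ) • spiral a ω p' β' := by rw [← e]; simp
      have hle := hz.duration_le h hτ (Or.inr rfl) hp' h0' e1
      have he := hz.eq_spiral h hτ e1 (right_mem_Icc.2 hτ)
      have hmem := spiral_mem_rightSet_of_le (β' := β' - ω * τ) hω hp' (by linarith) (by linarith)
        hπ' (e ▸ hr)
      rw [hzτ] at he
      rw [he, neg_one_smul] at hR
      exact neg_notMem_rightSet hmem hR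
  · rintro ⟨β', hle, hπ', hC, rfl⟩
    have h0' : 0 ≤ β' := h0.trans hle
    have e : ω * ((β' - β) / ω) = β' - β := by field_simp
    have hR' : spiral a ω p β' ∈ rightSet θ := by
      obtain ⟨b, hb, hbπ, hbC, hbR⟩ := exists_initial_phase hω h.threshold_pos hp h0 hπ hR
      rwa [initialCurve_phase_unique hω h.threshold_pos hp h0' hπ' (h0.trans hb) hbπ hC hbC]
    refine ⟨(β' - β) / ω, fun t => spiral a ω p (β' - ω * t), div_nonneg (by linarith) hω.le,
      isFlowArc_spiral h hp hπ' hR' (by linarith), by simp [e], by simp, hC, fun s hs hsC => ?_⟩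
    have h1 : ω * s ≤ β' - β := by
      rw [← e]; exact mul_le_mul_of_nonneg_left hs.2 hω.le
    have h2 := mul_pos hω hs.1
    have := initialCurve_phase_unique hω h.threshold_pos hp (by linarith) (by linarith) h0' hπ'
      hsC hC
    linarith

lemma isForwardPoint_neg_iff {x y : Plane} :
    IsForwardPoint m c k θ (-x) (-y) ↔ IsForwardPoint m c k θ x y := by
  have key : ∀ {x y : Plane}, IsForwardPoint m c k θ x y → IsForwardPoint m c k θ (-x) (-y) := by
    rintro x y ⟨τ, z, hτ, hz, rfl, rfl, hy, hs⟩
    exact ⟨τ, fun t => -z t, hτ, isFlowArc_neg_iff.2 hz, rfl, rfl, neg_mem_jumpSet.2 hy,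
      fun s hs' => by rw [neg_mem_jumpSet]; exact hs s hs'⟩
  exact ⟨fun h => by simpa using key h, key⟩

lemma isBackwardPoint_neg_iff {x y : Plane} :
    IsBackwardPoint m c k θ (-x) (-y) ↔ IsBackwardPoint m c k θ x y := by
  have key : ∀ {x y : Plane}, IsBackwardPoint m c k θ x y →
      IsBackwardPoint m c k θ (-x) (-y) := by
    rintro x y ⟨τ, z, hτ, hz, rfl, rfl, hy, hs⟩
    exact ⟨τ, fun t => -z t, hτ, isFlowArc_neg_iff.2 hz, rfl, rfl, neg_mem_initialCurve.2 hy,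
      fun s hs' => by rw [neg_mem_initialCurve]; exact hs s hs'⟩
  exact ⟨fun h => by simpa using key h, key⟩

lemma isFlowArc_const_zero : IsFlowArc m c k θ (fun _ => 0) 0 := by
  intro t ht
  refine ⟨?_, mem_flowSet_of_position_eq_zero rfl⟩
  have : vectorField m c k 0 = 0 := by apply plane_ext <;> simp [vectorField]
  simpa [this] using hasDerivWithinAt_const t (Icc (0 : ℝ) 0) (0 : Plane)

lemma isForwardPoint_zero_iff {y : Plane} : IsForwardPoint m c k θ 0 y ↔ y = 0 := by
  constructor
  · rintro ⟨τ, z, hτ, -, hz0, rfl, -, hs⟩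
    rcases hτ.eq_or_lt with rfl | hτ
    · exact hz0
    · exact absurd (by simp [hz0, jumpSet]) (hs 0 ⟨le_rfl, hτ⟩)
  · rintro rfl
    exact ⟨0, fun _ => 0, le_rfl, isFlowArc_const_zero, rfl, rfl, rfl, by simp⟩

lemma isBackwardPoint_zero_iff (h : Underdamped m c k θ a ω) {y : Plane} :
    IsBackwardPoint m c k θ 0 y ↔ y = 0 := by
  constructor
  · rintro ⟨τ, z, hτ, hz, hzτ, rfl, -⟩
    exact (hz.eq_zero_iff h hτ).1 hzτ
  · rintro rfl
    exact ⟨0, fun _ => 0, le_rfl, isFlowArc_const_zero, rfl, rfl,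
      Or.inr ⟨by simpa using h.threshold_pos.le, rfl⟩, by simp⟩

lemma existsUnique_points_of_mem_rightSet (h : Underdamped m c k θ a ω) {x : Plane}
    (hx : x ∈ rightSet θ) :
    (∃! y, IsBackwardPoint m c k θ x y) ∧ (∃! y, IsForwardPoint m c k θ x y) := by
  have hω := h.freq_pos
  obtain ⟨p, β, hp, h0, hπ, rfl⟩ := exists_eq_spiral_of_mem_rightSet (a := a) hω hx
  simp only [isBackwardPoint_spiral_iff h hp h0 hπ hx, isForwardPoint_spiral_iff h hp h0 hπ hx,
    existsUnique_eq, and_true]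
  obtain ⟨b, hb, hbπ, hbC, -⟩ := exists_initial_phase hω h.threshold_pos hp h0 hπ hx
  refine ⟨_, ⟨b, hb, hbπ, hbC, rfl⟩, ?_⟩
  rintro y ⟨b', hb', hbπ', hbC', rfl⟩
  rw [initialCurve_phase_unique hω h.threshold_pos hp (h0.trans hb) hbπ (h0.trans hb') hbπ'
    hbC hbC']

lemma existsUnique_points (h : Underdamped m c k θ a ω) {x : Plane} (hx : x ∈ flowSet θ) :
    (∃! y, IsBackwardPoint m c k θ x y) ∧ (∃! y, IsForwardPoint m c k θ x y) := by
  by_cases h0 : x = 0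
  · subst h0
    simp [isBackwardPoint_zero_iff h, isForwardPoint_zero_iff]
  rcases mem_rightSet_or_neg_mem hx h0 with hr | hr
  · exact existsUnique_points_of_mem_rightSet h hr
  · obtain ⟨⟨y, hy, hy'⟩, ⟨z, hz, hz'⟩⟩ := existsUnique_points_of_mem_rightSet h hr
    refine ⟨⟨-y, ?_, fun y' h' => ?_⟩, ⟨-z, ?_, fun z' h' => ?_⟩⟩
    · simpa using isBackwardPoint_neg_iff.2 hy
    · rw [← hy' (-y') (isBackwardPoint_neg_iff.2 h'), neg_neg]
    · simpa using isForwardPoint_neg_iff.2 hz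
    · rw [← hz' (-z') (isForwardPoint_neg_iff.2 h'), neg_neg]

lemma backwardPoint_eq (h : Underdamped m c k θ a ω) {x y : Plane} (hx : x ∈ flowSet θ)
    (hy : IsBackwardPoint m c k θ x y) : backwardPoint m c k θ x = y :=
  (existsUnique_points h hx).1.unique (Classical.epsilon_spec ⟨y, hy⟩) hy

lemma forwardPoint_eq (h : Underdamped m c k θ a ω) {x y : Plane} (hx : x ∈ flowSet θ)
    (hy : IsForwardPoint m c k θ x y) : forwardPoint m c k θ x = y :=
  (existsUnique_points h hx).2.unique (Classical.epsilon_spec ⟨y, hy⟩) hy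

/-! ### The set `A` as the level set of one amplitude. -/

lemma neg_mem_attractor (h : Underdamped m c k θ a ω) {x : Plane}
    (hx : x ∈ attractor m c k θ) : -x ∈ attractor m c k θ := by
  obtain ⟨hC, hT, h0⟩ := hx
  have hC' := neg_mem_flowSet.2 hC
  obtain ⟨⟨y, hy, -⟩, ⟨z, hz, -⟩⟩ := existsUnique_points h hC
  refine ⟨hC', ?_, neg_ne_zero.2 h0⟩
  simp only [backwardKinetic, forwardKinetic] at hT ⊢
  rw [backwardPoint_eq h hC hy, forwardPoint_eq h hC hz] at hT
  rw [backwardPoint_eq h hC' (isBackwardPoint_neg_iff.2 hy),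
    forwardPoint_eq h hC' (isForwardPoint_neg_iff.2 hz)]
  simpa using hT

/-- The forward velocity is `-p`, so equal kinetic energies say that the backward velocity is `p`;
then `p` is a fixed point of the half-turn map, and the contraction leaves only `p₀`. -/
lemma spiral_mem_attractor_iff {p₀ β₀ : ℝ} (h : Underdamped m c k θ a ω)
    (hfix : IsHalfTurn a ω θ p₀ p₀ β₀) (hp : 0 < p) (h0 : 0 ≤ β) (hπ : β < Real.pi)
    (hR : spiral a ω p β ∈ rightSet θ) :
    spiral a ω p β ∈ attractor m c k θ ↔ p = p₀ := by
  have hω := h.freq_pos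
  have hθ := h.threshold_pos
  obtain ⟨b, hb, hbπ, hbC, -⟩ := exists_initial_phase hω h.threshold_pos hp h0 hπ hR
  have hb0 := h0.trans hb
  have eb := backwardPoint_eq h hR.1
    ((isBackwardPoint_spiral_iff h hp h0 hπ hR).2 ⟨b, hb, hbπ, hbC, rfl⟩)
  have ef := forwardPoint_eq h hR.1 ((isForwardPoint_spiral_iff h hp h0 hπ hR).2 rfl)
  have hm := h.mass_pos
  have hiff : spiral a ω p β ∈ attractor m c k θ ↔ (spiral a ω p b 1) ^ 2 = p ^ 2 := by
    simp only [attractor, mem_ofPred_eq, hR.1, ne_zero_of_mem_rightSet hR, backwardKinetic,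
      forwardKinetic, eb, ef, true_and, ne_eq, not_false_eq_true, and_true]
    rw [mul_right_inj' (by positivity), spiral_zero_phase]
    simp
  rw [hiff]
  have hC := (spiral_mem_initialCurve_iff hω hθ hp hb0 hbπ).1 hbC
  constructor
  · intro hsq
    have h1 : spiral a ω p b 1 = p :=
      (pow_left_inj₀ ((spiral_velocity_nonneg_iff hp).2 hC.1) hp.le two_ne_zero).1 hsq
    -- Zero backward velocity would give `p = 0`; so the backward point is on the branch `|x₁| = θ`
    -- of `C₀`.
    have hne : velocityShape a ω b ≠ 0 := by
      intro e; rw [spiral_one_coord, e] at h1; simp at h1; linarith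
    have hpos : 0 < b := by
      rcases hb0.eq_or_lt with rfl | hb0
      · have := hC.1; rw [velocityShape_zero] at this; linarith
      · exact hb0
    have hturn : IsHalfTurn a ω θ p p b := by
      refine ⟨hp, hpos, hbπ, plane_ext ?_ ?_⟩
      · exact hC.2.2.resolve_right hne
      · exact h1
    have hle := hturn.abs_sq_sub_sq_le h.decay_pos hω hp.le hfix.1.le hfix
    have hq : Real.exp (-(a / ω * Real.pi)) < 1 := Real.exp_lt_one_iff.2 (by
      have := h.decay_pos
      have := Real.pi_pos
      have : 0 < a / ω * Real.pi := by positivity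
      linarith)
    have habs : |p ^ 2 - p₀ ^ 2| = 0 := by
      have := abs_nonneg (p ^ 2 - p₀ ^ 2)
      nlinarith
    exact (pow_left_inj₀ hp.le hfix.1.le two_ne_zero).1 (by linarith [abs_eq_zero.1 habs])
  · rintro rfl
    obtain ⟨-, hb1, hb2, e⟩ := hfix
    have : spiral a ω p β₀ ∈ initialCurve θ := by
      rw [e]; left
      simp [abs_of_pos hθ]; positivity
    rw [initialCurve_phase_unique hω hθ hp hb0 hbπ hb1.le hb2 hbC this, e]
    simp

lemma attractor_eq {p₀ β₀ : ℝ} (h : Underdamped m c k θ a ω)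
    (hfix : IsHalfTurn a ω θ p₀ p₀ β₀) :
    attractor m c k θ = spiral a ω p₀ '' Icc 0 β₀ ∪ (fun b => -spiral a ω p₀ b) '' Icc 0 β₀ := by
  have hω := h.freq_pos
  have hθ := h.threshold_pos
  have hRfix := hfix.mem_rightSet hω
  have hfix' := hfix
  obtain ⟨hp, hb1, hb2, e⟩ := hfix'
  have hC : spiral a ω p₀ β₀ ∈ initialCurve θ := by
    rw [e]; left
    simp [abs_of_pos hθ]; positivity
  have hmem : ∀ x ∈ rightSet θ, x ∈ attractor m c k θ → x ∈ spiral a ω p₀ '' Icc 0 β₀ := by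
    intro x hx hA
    obtain ⟨p, β, hp', h0, hπ, rfl⟩ := exists_eq_spiral_of_mem_rightSet (a := a) hω hx
    obtain rfl := (spiral_mem_attractor_iff h hfix hp' h0 hπ hx).1 hA
    obtain ⟨b, hb, hbπ, hbC, -⟩ := exists_initial_phase hω h.threshold_pos hp' h0 hπ hx
    rw [initialCurve_phase_unique hω hθ hp (h0.trans hb) hbπ hb1.le hb2 hbC hC] at hb
    exact ⟨β, ⟨h0, hb⟩, rfl⟩
  have hmem' : ∀ b ∈ Icc 0 β₀, spiral a ω p₀ b ∈ attractor m c k θ := fun b hb =>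
    (spiral_mem_attractor_iff h hfix hp hb.1 (hb.2.trans_lt hb2)
      (spiral_mem_rightSet_of_le hω hp hb.1 hb.2 hb2 hRfix)).2 rfl
  ext x
  constructor
  · intro hx
    rcases mem_rightSet_or_neg_mem hx.1 hx.2.2 with hr | hr
    · exact Or.inl (hmem x hr hx)
    · obtain ⟨b, hb, e⟩ := hmem _ hr (neg_mem_attractor h hx)
      exact Or.inr ⟨b, hb, by simp [e]⟩
  · rintro (⟨b, hb, rfl⟩ | ⟨b, hb, rfl⟩)
    · exact hmem' b hb
    · exact neg_mem_attractor h (hmem' b hb)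

lemma isCompact_attractor (h : Underdamped m c k θ a ω) : IsCompact (attractor m c k θ) := by
  obtain ⟨p₀, β₀, hfix⟩ := exists_isHalfTurn_fixed h.decay_pos h.freq_pos h.threshold_pos
  rw [attractor_eq h hfix]
  have hc : Continuous (spiral a ω p₀) := continuous_spiral.comp (Continuous.prodMk_right p₀)
  exact (isCompact_Icc.image hc).union (isCompact_Icc.image hc.neg)

lemma attractor_nonempty (h : Underdamped m c k θ a ω) : (attractor m c k θ).Nonempty := by
  obtain ⟨p₀, β₀, hfix⟩ := exists_isHalfTurn_fixed h.decay_pos h.freq_pos h.threshold_pos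
  rw [attractor_eq h hfix]
  exact ⟨_, Or.inl ⟨0, ⟨le_rfl, hfix.2.1.le⟩, rfl⟩⟩

lemma infDist_smul_attractor (h : Underdamped m c k θ a ω) {e : ℝ} (he : e = 1 ∨ e = -1)
    (x : Plane) : Metric.infDist (e • x) (attractor m c k θ) =
      Metric.infDist x (attractor m c k θ) := by
  rcases he with rfl | rfl
  · rw [one_smul]
  · have himg : (fun y : Plane => -y) '' attractor m c k θ = attractor m c k θ := by
      ext y
      constructor
      · rintro ⟨z, hz, rfl⟩; exact neg_mem_attractor h hz
      · intro hy; exact ⟨-y, neg_mem_attractor h hy, neg_neg y⟩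
    have hiso : Isometry fun y : Plane => -y := (LinearIsometryEquiv.neg ℝ).isometry
    have := Metric.infDist_image (x := x) (t := attractor m c k θ) hiso
    rw [himg] at this
    rw [neg_one_smul]
    exact this

lemma infDist_zero_attractor_pos (h : Underdamped m c k θ a ω) :
    0 < Metric.infDist 0 (attractor m c k θ) :=
  ((isCompact_attractor h).isClosed.notMem_iff_infDist_pos (attractor_nonempty h)).1
    fun h0 => h0.2.2 rfl

/-! ### Amplitude error versus distance to `A`. -/

/-- Parameters `(p, β)` of a compact set that contains all points of the right half of the flow set
with `p ≤ M`. -/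
def spiralParams (a ω θ M : ℝ) : Set (ℝ × ℝ) :=
  (Icc 0 M ×ˢ Icc 0 Real.pi) ∩
    ({q | 0 ≤ velocityShape a ω q.2} ∪ {q | θ ≤ spiral a ω q.1 q.2 0})

lemma isCompact_spiralParams (M : ℝ) : IsCompact (spiralParams a ω θ M) := by
  refine (isCompact_Icc.prod isCompact_Icc).inter_right (IsClosed.union ?_ ?_)
  · exact isClosed_le continuous_const (continuous_velocityShape.comp continuous_snd)
  · exact isClosed_le continuous_const ((continuous_coord 0).comp continuous_spiral)

lemma mem_rightSet_of_mem_spiralParams (hω : 0 < ω) (hθ : 0 < θ) {M : ℝ} {q : ℝ × ℝ}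
    (hq : q ∈ spiralParams a ω θ M) (hp : 0 < q.1) :
    q.2 < Real.pi ∧ spiral a ω q.1 q.2 ∈ rightSet θ := by
  obtain ⟨⟨-, h0, hπ⟩, h3⟩ := hq
  have hlt : q.2 < Real.pi := by
    refine lt_of_le_of_ne hπ fun e => ?_
    simp only [mem_union, mem_ofPred_eq, e, velocityShape_pi, spiral_zero_coord] at h3
    rcases h3 with h3 | h3
    · linarith
    · simp at h3; linarith
  exact ⟨hlt, (spiral_mem_rightSet_iff hω hp h0 hlt).2 h3⟩

lemma mem_spiralParams (hω : 0 < ω) {M : ℝ} (hp : 0 < p) (hM : p ≤ M) (h0 : 0 ≤ β)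
    (hπ : β < Real.pi) (hR : spiral a ω p β ∈ rightSet θ) : (p, β) ∈ spiralParams a ω θ M :=
  ⟨⟨⟨hp.le, hM⟩, h0, hπ.le⟩, (spiral_mem_rightSet_iff hω hp h0 hπ).1 hR⟩

/-- On the compact set of parameters at distance at least `ε` from `A`, the amplitude error is
continuous and never zero, hence bounded below. -/
lemma exists_infDist_le_of_abs_sq_sub_le {p₀ β₀ : ℝ} (h : Underdamped m c k θ a ω)
    (hfix : IsHalfTurn a ω θ p₀ p₀ β₀) {ε : ℝ} (hε : 0 < ε) :
    ∃ η > 0, ∀ p β, 0 < p → 0 ≤ β → β < Real.pi → spiral a ω p β ∈ rightSet θ →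
      |p ^ 2 - p₀ ^ 2| ≤ η → Metric.infDist (spiral a ω p β) (attractor m c k θ) ≤ ε := by
  have hω := h.freq_pos
  have hp₀ := hfix.1
  set K := spiralParams a ω θ (p₀ + 1) ∩
    {q | ε ≤ Metric.infDist (spiral a ω q.1 q.2) (attractor m c k θ)} with hK
  have hcomp : IsCompact K := (isCompact_spiralParams _).inter_right
    (isClosed_le continuous_const ((Metric.continuous_infDist_pt _).comp continuous_spiral))
  obtain ⟨η, hη, hη'⟩ := hcomp.exists_forall_le' (f := fun q : ℝ × ℝ => |q.1 ^ 2 - p₀ ^ 2|)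
    (by fun_prop) (a := 0) (by
      intro q hq
      rw [abs_pos, sub_ne_zero]
      intro e
      obtain ⟨hq1, hq2⟩ := hq
      have e' : q.1 = p₀ := (pow_left_inj₀ hq1.1.1.1 hp₀.le two_ne_zero).1 e
      have hpos : 0 < q.1 := by rw [e']; exact hp₀
      obtain ⟨h1, h2⟩ := mem_rightSet_of_mem_spiralParams hω h.threshold_pos hq1 hpos
      have h3 := (spiral_mem_attractor_iff h hfix hpos hq1.1.2.1 h1 h2).2 e'
      rw [mem_ofPred_eq, Metric.infDist_zero_of_mem h3] at hq2
      linarith)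
  -- The bound `1` keeps `p ≤ p₀ + 1`, inside the compact box; `η / 2` contradicts the lower bound
  -- `η` strictly.
  refine ⟨min (η / 2) 1, by positivity, fun p β hp h0 hπ hR hle => ?_⟩
  by_contra! hcon
  have hpM : p ≤ p₀ + 1 := by
    have h1 := (le_abs_self _).trans (hle.trans (min_le_right _ _))
    nlinarith
  have := hη' (p, β) ⟨mem_spiralParams hω hp hpM h0 hπ hR, hcon.le⟩
  have h2 := hle.trans (min_le_left _ _)
  simp only at this
  linarith

lemma le_norm_phaseCoord_spiral (ha : 0 < a) (hω : 0 < ω) (hp : 0 < p) (h0 : 0 ≤ β) :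
    p ≤ ‖phaseCoord a ω (spiral a ω p β)‖ := by
  rw [norm_phaseCoord_spiral hω hp.le]
  exact le_mul_of_one_le_right hp.le (Real.one_le_exp (by positivity))

lemma exists_abs_sq_sub_le_of_infDist_le {p₀ β₀ : ℝ} (h : Underdamped m c k θ a ω)
    (hfix : IsHalfTurn a ω θ p₀ p₀ β₀) {η : ℝ} (hη : 0 < η) :
    ∃ δ > 0, ∀ p β, 0 < p → 0 ≤ β → β < Real.pi → spiral a ω p β ∈ rightSet θ →
      Metric.infDist (spiral a ω p β) (attractor m c k θ) ≤ δ → |p ^ 2 - p₀ ^ 2| ≤ η := by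
  have hω := h.freq_pos
  have hA := isCompact_attractor h
  have hAne := attractor_nonempty h
  obtain ⟨R, hRA⟩ := hA.isBounded.exists_norm_le
  -- A point within distance `2` of `A` has norm at most `R + 2`, and the amplitude is at most the
  -- modulus of the complex coordinate.
  set M := ‖phaseCoord a ω‖ * (R + 2) with hM
  set K := spiralParams a ω θ M ∩ {q | η ≤ |q.1 ^ 2 - p₀ ^ 2|} with hK
  have hcomp : IsCompact K := (isCompact_spiralParams _).inter_right
    (isClosed_le continuous_const (by fun_prop))
  obtain ⟨δ, hδ, hδ'⟩ := hcomp.exists_forall_le'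
    (f := fun q : ℝ × ℝ => Metric.infDist (spiral a ω q.1 q.2) (attractor m c k θ))
    ((Metric.continuous_infDist_pt _).comp continuous_spiral).continuousOn (a := 0) (by
      rintro q ⟨hq1, hq2⟩
      rw [← hA.isClosed.notMem_iff_infDist_pos hAne]
      -- The compact box contains `p = 0`, which parametrises only the origin; the origin is not in
      -- `A`.
      rcases (hq1.1.1.1 : (0 : ℝ) ≤ q.1).eq_or_lt with e | hpos
      · intro hmem
        refine hmem.2.2 ?_
        rw [← e]
        apply plane_ext <;> simp
      · obtain ⟨h1, h2⟩ := mem_rightSet_of_mem_spiralParams hω h.threshold_pos hq1 hpos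
        rw [spiral_mem_attractor_iff h hfix hpos hq1.1.2.1 h1 h2]
        intro e
        simp only [mem_ofPred_eq, e, sub_self, abs_zero] at hq2
        linarith)
  refine ⟨min (δ / 2) 1, by positivity, fun p β hp h0 hπ hR hle => ?_⟩
  by_contra! hcon
  have hpM : p ≤ M := by
    obtain ⟨y, hy, hd⟩ := (Metric.infDist_lt_iff hAne).1
      ((hle.trans (min_le_right _ _)).trans_lt one_lt_two)
    refine (le_norm_phaseCoord_spiral h.decay_pos hω hp h0).trans
      (((phaseCoord a ω).le_opNorm _).trans ?_)
    refine mul_le_mul_of_nonneg_left ?_ (norm_nonneg _)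
    have := norm_le_norm_add_norm_sub' (spiral a ω p β) y
    rw [← dist_eq_norm] at this
    linarith [hRA y hy]
  have := hδ' (p, β) ⟨mem_spiralParams hω hp hpM h0 hπ hR, hcon.le⟩
  have h2 := hle.trans (min_le_left _ _)
  simp only at this
  linarith

end ResetOscillator

/-! ### Hybrid time domains. -/

namespace IsHybridTimeDomain

variable {S : Set (ℝ × ℕ)}

lemma mem_of_le_of_le (hS : IsHybridTimeDomain S) {s t u : ℝ} {j : ℕ} (hs : (s, j) ∈ S)
    (ht : (t, j) ∈ S) (hsu : s ≤ u) (hut : u ≤ t) : (u, j) ∈ S := by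
  obtain ⟨N, τ, -, -, hN⟩ := hS.2 _ ht
  have h0 := hS.1 _ hs
  have hs' : (s, j) ∈ S ∩ (Icc 0 (t, j).1 ×ˢ Iic (t, j).2) :=
    ⟨hs, ⟨h0, hsu.trans hut⟩, mem_Iic.2 le_rfl⟩
  have ht' : (t, j) ∈ S ∩ (Icc 0 (t, j).1 ×ˢ Iic (t, j).2) :=
    ⟨ht, ⟨hS.1 _ ht, le_rfl⟩, mem_Iic.2 le_rfl⟩
  have hu' : (u, j) ∈ S ∩ (Icc 0 (t, j).1 ×ˢ Iic (t, j).2) := by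
    rw [hN] at hs' ht' ⊢
    exact ⟨hs'.1, hs'.2.1.trans hsu, hut.trans ht'.2.2⟩
  exact hu'.1

lemma exists_jump (hS : IsHybridTimeDomain S) {t : ℝ} {j : ℕ} (ht : (t, j + 1) ∈ S) :
    ∃ s ≤ t, (s, j) ∈ S ∧ (s, j + 1) ∈ S := by
  obtain ⟨N, τ, -, hτ, hN⟩ := hS.2 _ ht
  have ht' : (t, j + 1) ∈ S ∩ (Icc 0 (t, j + 1).1 ×ˢ Iic (t, j + 1).2) :=
    ⟨ht, ⟨hS.1 _ ht, le_rfl⟩, mem_Iic.2 le_rfl⟩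
  rw [hN] at ht'
  obtain ⟨h1, h2, h3⟩ := ht'
  simp only at h1 h2 h3
  refine ⟨τ (j + 1), h2, ?_, ?_⟩
  · have : (τ (j + 1), j) ∈ S ∩ (Icc 0 (t, j + 1).1 ×ˢ Iic (t, j + 1).2) := by
      rw [hN]
      exact ⟨show j < N by omega, hτ j (by omega), le_rfl⟩
    exact this.1
  · have : (τ (j + 1), j + 1) ∈ S ∩ (Icc 0 (t, j + 1).1 ×ˢ Iic (t, j + 1).2) := by
      rw [hN]
      exact ⟨h1, le_rfl, h2.trans h3⟩
    exact this.1

/-- The hybrid time domain with jumps at the times `τ (j + 1)`. -/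
lemma of_monotone {τ : ℕ → ℝ} (hτ : Monotone τ) (h0 : τ 0 = 0) :
    IsHybridTimeDomain {q | q.1 ∈ Icc (τ q.2) (τ (q.2 + 1))} := by
  have hnn : ∀ j, 0 ≤ τ j := fun j => h0 ▸ hτ (Nat.zero_le j)
  refine ⟨fun q hq => (hnn _).trans hq.1, ?_⟩
  rintro ⟨T, J⟩ ⟨hT1, hT2⟩
  simp only at hT1 hT2
  -- Truncation at `(T, J)` keeps the jump times up to index `J` and cuts the last interval at `T`.
  refine ⟨J + 1, fun j => if j ≤ J then τ j else T, by simpa using h0, fun j hj => ?_, ?_⟩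
  · rcases (Nat.lt_succ_iff.1 hj).eq_or_lt with rfl | hlt
    · simpa using hT1
    · have : j + 1 ≤ J := hlt
      simp only [hlt.le, if_true, this]
      exact hτ (Nat.le_succ j)
  · ext ⟨u, i⟩
    simp only [mem_inter_iff, mem_ofPred_eq, mem_prod, mem_Icc, mem_Iic, Nat.lt_succ_iff]
    constructor
    · rintro ⟨⟨h1, h2⟩, ⟨h3, h4⟩, h5⟩
      refine ⟨h5, by simpa [h5] using h1, ?_⟩
      split_ifs
      · exact h2
      · exact h4
    · rintro ⟨h5, h1, h2⟩
      simp only [h5, if_true] at h1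
      refine ⟨⟨h1, ?_⟩, ⟨(hnn _).trans h1, ?_⟩, h5⟩
      · split_ifs at h2 with h6
        · exact h2
        · have : i = J := by omega
          subst this
          exact h2.trans hT2
      · split_ifs at h2 with h6
        · exact h2.trans ((hτ h6).trans hT1)
        · exact h2

end IsHybridTimeDomain

/-! ### Solutions as sequences of half turns. -/

namespace ResetOscillator

variable {m c k θ a ω : ℝ}

lemma flows_of_isSolution {φ : HybridTrajectory Plane} (hφ : (system m c k θ).IsSolution φ)
    {s t : ℝ} {j : ℕ} (hst : s ≤ t) (hs : (s, j) ∈ φ.dom) (ht : (t, j) ∈ φ.dom) :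
    AbsolutelyContinuousOnInterval (fun u => φ.val u j) s t ∧
      (∀ᵐ u : ℝ, u ∈ Ioo s t →
        HasDerivAt (fun u => φ.val u j) (vectorField m c k (φ.val u j)) u) ∧
      ∀ u ∈ Ioo s t, φ.val u j ∈ flowSet θ := by
  have hsub : Icc s t ⊆ φ.interval j := fun u hu =>
    hφ.domain.mem_of_le_of_le hs ht hu.1 hu.2
  have hint : Ioo s t ⊆ interior (φ.interval j) :=
    interior_maximal (Ioo_subset_Icc_self.trans hsub) isOpen_Ioo
  refine ⟨hφ.absCont j s t hst hsub, ?_, fun u hu => hφ.flow_mem j u (hint hu)⟩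
  filter_upwards [hφ.flow_deriv j] with u hu huu
  obtain ⟨v, rfl, hv⟩ := hu (hint huu)
  exact hv

lemma phaseCoord_solution (h : Underdamped m c k θ a ω) {φ : HybridTrajectory Plane}
    (hφ : (system m c k θ).IsSolution φ) {s t : ℝ} {j : ℕ} (hst : s ≤ t) (hs : (s, j) ∈ φ.dom)
    (ht : (t, j) ∈ φ.dom) :
    phaseCoord a ω (φ.val t j) =
      Complex.exp (-((a : ℂ) + ω * Complex.I) * ((t - s : ℝ) : ℂ)) *
        phaseCoord a ω (φ.val s j) := by
  obtain ⟨h1, h2, -⟩ := flows_of_isSolution hφ hst hs ht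
  exact phaseCoord_free_motion h hst h1 h2 (right_mem_Icc.2 hst)

lemma solution_eq_zero_iff (h : Underdamped m c k θ a ω) {φ : HybridTrajectory Plane}
    (hφ : (system m c k θ).IsSolution φ) {s t : ℝ} {j : ℕ} (hst : s ≤ t) (hs : (s, j) ∈ φ.dom)
    (ht : (t, j) ∈ φ.dom) : φ.val t j = 0 ↔ φ.val s j = 0 := by
  have h2 := phaseCoord_injective (a := a) h.freq_pos
  rw [← map_eq_zero_iff _ h2, phaseCoord_solution h hφ hst hs ht,
    ← map_eq_zero_iff (phaseCoord a ω) h2 (x := φ.val s j)]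
  simp [Complex.exp_ne_zero]

/-- Damping strictly shrinks the modulus of the complex coordinate during flow, so only the origin
recurs without a jump. -/
lemma solution_eq_zero_of_recurrence (h : Underdamped m c k θ a ω) {φ : HybridTrajectory Plane}
    (hφ : (system m c k θ).IsSolution φ) {s t : ℝ} {j : ℕ} (hst : s < t) (hs : (s, j) ∈ φ.dom)
    (ht : (t, j) ∈ φ.dom) (he : φ.val s j = φ.val t j) : φ.val s j = 0 := by
  have h1 := phaseCoord_solution h hφ hst.le hs ht
  have h2 := congrArg (fun w : ℂ => ‖w‖) h1
  have ha := h.decay_pos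
  rw [← he, norm_mul, Complex.norm_exp] at h2
  have h3 : (-((a : ℂ) + ω * Complex.I) * ((t - s : ℝ) : ℂ)).re = -(a * (t - s)) := by
    simp
  have h4 : Real.exp (-(a * (t - s))) < 1 := Real.exp_lt_one_iff.2 (by nlinarith)
  rw [h3] at h2
  rw [← map_eq_zero_iff _ (phaseCoord_injective (a := a) h.freq_pos), ← norm_eq_zero]
  have := norm_nonneg (phaseCoord a ω (φ.val s j))
  nlinarith

lemma ne_zero_of_mem_jumpMap (hθ : 0 < θ) {x y : Plane} (hy : y ∈ jumpMap θ x) : y ≠ 0 := by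
  rintro rfl
  obtain ⟨s, hs, e⟩ := hy
  have h0 := congrArg (fun z : Plane => z 0) e
  have hs0 : s = 0 := by simpa [hθ.ne'] using h0
  subst hs0
  simp only [setSign] at hs
  split_ifs at hs with h1
  · simp at hs
  · exact h1 (Real.sign_eq_zero_iff.1 (Eq.symm hs))

lemma solution_ne_zero_of_jumped (h : Underdamped m c k θ a ω) {φ : HybridTrajectory Plane}
    (hφ : (system m c k θ).IsSolution φ) {t : ℝ} {j : ℕ} (ht : (t, j + 1) ∈ φ.dom) :
    φ.val t (j + 1) ≠ 0 := by
  obtain ⟨s, hst, h1, h2⟩ := hφ.domain.exists_jump ht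
  rw [Ne, solution_eq_zero_iff h hφ hst h2 ht]
  exact ne_zero_of_mem_jumpMap h.threshold_pos (hφ.jump s j h1 h2).2

lemma solution_initial_mem_flowSet {φ : HybridTrajectory Plane}
    (hφ : (system m c k θ).IsSolution φ) : φ.val 0 0 ∈ flowSet θ := by
  rcases hφ.init with h | h
  · exact isClosed_flowSet.closure_subset h
  · exact mem_flowSet_of_position_eq_zero h

/-- The velocity is nonzero, so the set-valued sign has one value; the jump switches halves, which
is why the sign alternates along a solution. -/
lemma mem_jumpMap_iff {e p : ℝ} (he : e = 1 ∨ e = -1) (hp : 0 < p) {y : Plane} :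
    y ∈ jumpMap θ (e • !₂[0, -p]) ↔ y = (-e) • !₂[θ, p] := by
  rcases he with rfl | rfl
  · simp only [jumpMap, setSign, mem_ofPred_eq]
    have h1 : ((1 : ℝ) • !₂[(0 : ℝ), -p] : Plane) 1 = -p := by simp
    have h2 : !₂[-θ, -p] = -(!₂[θ, p] : Plane) := by apply plane_ext <;> simp
    rw [h1, if_neg (by linarith), Real.sign_of_neg (by linarith)]
    simp [h2]
  · simp only [jumpMap, setSign, mem_ofPred_eq]
    have h1 : ((-1 : ℝ) • !₂[(0 : ℝ), -p] : Plane) 1 = p := by simp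
    rw [h1, if_neg hp.ne', Real.sign_of_pos hp]
    simp

/-- `p j` and `β j` are the parameters of the `j`-th flow arc of a solution: it starts at phase
`β j` and ends, up to sign, at `(0, -p j)`. -/
structure IsTurnSequence (a ω θ : ℝ) (p β : ℕ → ℝ) : Prop where
  pos_zero : 0 < p 0
  phase_nonneg_zero : 0 ≤ β 0
  phase_lt_pi_zero : β 0 < Real.pi
  mem_zero : spiral a ω (p 0) (β 0) ∈ rightSet θ
  halfTurn : ∀ j, IsHalfTurn a ω θ (p j) (p (j + 1)) (β (j + 1))

/-- The jump times of the solution with phases `β`. -/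
noncomputable def turnTime (ω : ℝ) (β : ℕ → ℝ) (j : ℕ) : ℝ := ∑ i ∈ Finset.range j, β i / ω

/-- The complete solution with arcs `(p j, β j)` that starts, up to the sign `e`, in the right half
of the flow set. -/
noncomputable def turnSolution (a ω e : ℝ) (p β : ℕ → ℝ) : HybridTrajectory Plane where
  dom := {q | q.1 ∈ Icc (turnTime ω β q.2) (turnTime ω β (q.2 + 1))}
  val t j := (e * (-1) ^ j) • spiral a ω (p j) (β j - ω * (t - turnTime ω β j))

lemma sign_mul_pow {e : ℝ} (he : e = 1 ∨ e = -1) (j : ℕ) :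
    e * (-1) ^ j = 1 ∨ e * (-1) ^ j = -1 := by
  rcases he with rfl | rfl <;> rcases neg_one_pow_eq_or ℝ j with h | h <;> simp [h]

lemma exists_isTurnSequence (h : Underdamped m c k θ a ω) {x : Plane} (hx : x ∈ flowSet θ)
    (h0 : x ≠ 0) : ∃ (e : ℝ) (p β : ℕ → ℝ), (e = 1 ∨ e = -1) ∧ IsTurnSequence a ω θ p β ∧
      x = e • spiral a ω (p 0) (β 0) := by
  have key : ∀ y ∈ rightSet θ, ∃ p β, IsTurnSequence a ω θ p β ∧ y = spiral a ω (p 0) (β 0) := by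
    intro y hy
    obtain ⟨p₁, β₁, hp, h0, hπ, rfl⟩ := exists_eq_spiral_of_mem_rightSet (a := a) h.freq_pos hy
    choose P B hPB using exists_isHalfTurn (a := a) h.freq_pos h.threshold_pos
    exact ⟨fun j => (Nat.rec (p₁, β₁) (fun _ q => (P q.1, B q.1)) j : ℝ × ℝ).1,
      fun j => (Nat.rec (p₁, β₁) (fun _ q => (P q.1, B q.1)) j : ℝ × ℝ).2,
      ⟨hp, h0, hπ, hy, fun j => hPB _⟩, rfl⟩
  rcases mem_rightSet_or_neg_mem hx h0 with hr | hr
  · obtain ⟨p, β, hs, e⟩ := key _ hr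
    exact ⟨1, p, β, Or.inl rfl, hs, by rw [e, one_smul]⟩
  · obtain ⟨p, β, hs, e⟩ := key _ hr
    exact ⟨-1, p, β, Or.inr rfl, hs, by rw [← e]; simp⟩

namespace IsTurnSequence

variable {p β : ℕ → ℝ}

lemma pos (h : IsTurnSequence a ω θ p β) : ∀ j, 0 < p j
  | 0 => h.pos_zero
  | j + 1 => (h.halfTurn j).1

lemma phase_nonneg (h : IsTurnSequence a ω θ p β) : ∀ j, 0 ≤ β j
  | 0 => h.phase_nonneg_zero
  | j + 1 => (h.halfTurn j).2.1.le

lemma phase_lt_pi (h : IsTurnSequence a ω θ p β) : ∀ j, β j < Real.pi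
  | 0 => h.phase_lt_pi_zero
  | j + 1 => (h.halfTurn j).2.2.1

lemma mem_rightSet (h : IsTurnSequence a ω θ p β) (hω : 0 < ω) :
    ∀ j, spiral a ω (p j) (β j) ∈ rightSet θ
  | 0 => h.mem_zero
  | j + 1 => (h.halfTurn j).mem_rightSet hω

lemma turnTime_succ (j : ℕ) : turnTime ω β (j + 1) = turnTime ω β j + β j / ω :=
  Finset.sum_range_succ _ _

lemma monotone_turnTime (h : IsTurnSequence a ω θ p β) (hω : 0 < ω) : Monotone (turnTime ω β) :=
  monotone_nat_of_le_succ fun j => by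
    rw [turnTime_succ]
    have := div_nonneg (h.phase_nonneg j) hω.le
    linarith

lemma turnTime_le (h : IsTurnSequence a ω θ p β) (hω : 0 < ω) (j : ℕ) :
    turnTime ω β j ≤ j * (Real.pi / ω) := by
  have : turnTime ω β j ≤ ∑ i ∈ Finset.range j, Real.pi / ω :=
    Finset.sum_le_sum fun i _ => div_le_div_of_nonneg_right (h.phase_lt_pi i).le hω.le
  simpa using this

lemma mem_dom_iff (hω : 0 < ω) {e t : ℝ} {j : ℕ} :
    (t, j) ∈ (turnSolution a ω e p β).dom ↔
      turnTime ω β j ≤ t ∧ ω * (t - turnTime ω β j) ≤ β j := by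
  have : t ≤ turnTime ω β (j + 1) ↔ ω * (t - turnTime ω β j) ≤ β j := by
    rw [turnTime_succ, mul_comm, ← le_div_iff₀ hω, sub_le_iff_le_add']
  simp only [turnSolution, mem_ofPred_eq, mem_Icc, this]

lemma phase_bounds (hω : 0 < ω) {e t : ℝ} {j : ℕ}
    (ht : (t, j) ∈ (turnSolution a ω e p β).dom) :
    0 ≤ β j - ω * (t - turnTime ω β j) ∧ β j - ω * (t - turnTime ω β j) ≤ β j := by
  obtain ⟨h1, h2⟩ := (mem_dom_iff hω).1 ht
  have := mul_nonneg hω.le (sub_nonneg.2 h1)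
  exact ⟨by linarith, by linarith⟩

lemma spiral_mem (h : IsTurnSequence a ω θ p β) (hω : 0 < ω) {e t : ℝ} {j : ℕ}
    (ht : (t, j) ∈ (turnSolution a ω e p β).dom) :
    spiral a ω (p j) (β j - ω * (t - turnTime ω β j)) ∈ rightSet θ := by
  obtain ⟨h1, h2⟩ := phase_bounds hω ht
  exact spiral_mem_rightSet_of_le hω (h.pos j) h1 h2 (h.phase_lt_pi j) (h.mem_rightSet hω j)

lemma val_mem_jumpSet (h : IsTurnSequence a ω θ p β) (hω : 0 < ω) {e t : ℝ} {j : ℕ}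
    (he : e = 1 ∨ e = -1) (ht : (t, j) ∈ (turnSolution a ω e p β).dom)
    (hD : (turnSolution a ω e p β).val t j ∈ jumpSet) : t = turnTime ω β (j + 1) := by
  obtain ⟨h1, h2⟩ := phase_bounds hω ht
  have hD' : spiral a ω (p j) (β j - ω * (t - turnTime ω β j)) ∈ jumpSet := by
    simp only [turnSolution] at hD
    rcases sign_mul_pow he j with h3 | h3
    · simpa [h3] using hD
    · rwa [h3, neg_one_smul, neg_mem_jumpSet] at hD
  rw [spiral_mem_jumpSet_iff hω (h.pos j) h1 (h2.trans_lt (h.phase_lt_pi j))] at hD'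
  have h3 : β j / ω = t - turnTime ω β j := by rw [div_eq_iff hω.ne']; linarith
  rw [turnTime_succ, h3]; ring

lemma val_turnTime_succ (hω : 0 < ω) {e : ℝ} (j : ℕ) :
    (turnSolution a ω e p β).val (turnTime ω β (j + 1)) j = (e * (-1) ^ j) • !₂[0, -p j] := by
  have : β j - ω * (turnTime ω β (j + 1) - turnTime ω β j) = 0 := by
    rw [turnTime_succ]; field_simp; ring
  simp only [turnSolution, this, spiral_zero_phase]

lemma val_succ_turnTime_succ (h : IsTurnSequence a ω θ p β) {e : ℝ} (j : ℕ) :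
    (turnSolution a ω e p β).val (turnTime ω β (j + 1)) (j + 1) =
      (-(e * (-1) ^ j)) • !₂[θ, p j] := by
  simp only [turnSolution, sub_self, mul_zero, sub_zero, (h.halfTurn j).2.2.2]
  congr 1; ring

lemma turnTime_mem (h : IsTurnSequence a ω θ p β) (hω : 0 < ω) (e : ℝ) (j : ℕ) :
    (turnTime ω β j, j) ∈ (turnSolution a ω e p β).dom :=
  ⟨le_rfl, h.monotone_turnTime hω (Nat.le_succ j)⟩

lemma val_mem_flowSet (h : IsTurnSequence a ω θ p β) (hω : 0 < ω) {e t : ℝ} {j : ℕ}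
    (he : e = 1 ∨ e = -1) (ht : (t, j) ∈ (turnSolution a ω e p β).dom) :
    (turnSolution a ω e p β).val t j ∈ flowSet θ := by
  have h1 := (h.spiral_mem hω ht).1
  simp only [turnSolution]
  rcases sign_mul_pow he j with h3 | h3
  · simpa [h3] using h1
  · rwa [h3, neg_one_smul, neg_mem_flowSet]

lemma isSolution (hs : IsTurnSequence a ω θ p β) (h : Underdamped m c k θ a ω) {e : ℝ}
    (he : e = 1 ∨ e = -1) : (system m c k θ).IsSolution (turnSolution a ω e p β) where
  domain := .of_monotone (hs.monotone_turnTime h.freq_pos) (by simp [turnTime])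
  zero_mem := by simpa [turnTime] using hs.turnTime_mem h.freq_pos e 0
  absCont j s t _ _ :=
    (contDiff_spiral (e * (-1) ^ j) (p j) (β j) (turnTime ω β j)).absolutelyContinuousOnInterval s t
  init := by
    have := hs.val_mem_flowSet h.freq_pos he (hs.turnTime_mem h.freq_pos e 0)
    have h0 : turnTime ω β 0 = 0 := by simp [turnTime]
    rw [h0] at this
    exact Or.inl (subset_closure this)
  flow_mem j t ht := by
    have ht' : t ∈ (turnSolution a ω e p β).interval j := interior_subset ht
    exact hs.val_mem_flowSet h.freq_pos he ht'
  flow_deriv j := Eventually.of_forall fun t _ =>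
    ⟨_, rfl, hasDerivAt_spiral h (e * (-1) ^ j) (p j) (β j) (turnTime ω β j) t⟩
  jump t j h1 h2 := by
    have ht : t = turnTime ω β (j + 1) := le_antisymm h1.2 h2.1
    subst ht
    have hval := val_turnTime_succ (a := a) (p := p) (β := β) h.freq_pos (e := e) j
    constructor
    · rw [hval]; simp [system, jumpSet]
    · change _ ∈ jumpMap θ _
      rw [hval, mem_jumpMap_iff (sign_mul_pow he j) (hs.pos j)]
      exact hs.val_succ_turnTime_succ j

lemma isComplete (hs : IsTurnSequence a ω θ p β) (hω : 0 < ω) (e : ℝ) :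
    (turnSolution a ω e p β).IsComplete := by
  intro N
  obtain ⟨n, hn⟩ := exists_nat_ge N
  refine ⟨_, hs.turnTime_mem hω e n, ?_⟩
  have : 0 ≤ turnTime ω β n := by
    have := hs.monotone_turnTime hω (Nat.zero_le n)
    simpa [turnTime] using this
  simp only
  linarith

/-- Every solution is a restriction of the complete one with the same initial point. -/
lemma solution_eq (hs : IsTurnSequence a ω θ p β) (h : Underdamped m c k θ a ω) {e : ℝ}
    (he : e = 1 ∨ e = -1) {φ : HybridTrajectory Plane} (hφ : (system m c k θ).IsSolution φ)
    (h0 : φ.val 0 0 = e • spiral a ω (p 0) (β 0)) (j : ℕ) : ∀ t, (t, j) ∈ φ.dom →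
      (t, j) ∈ (turnSolution a ω e p β).dom ∧
        φ.val t j = (turnSolution a ω e p β).val t j := by
  have hω := h.freq_pos
  have flow : ∀ j t, turnTime ω β j ≤ t → (turnTime ω β j, j) ∈ φ.dom → (t, j) ∈ φ.dom →
      φ.val (turnTime ω β j) j = (e * (-1) ^ j) • spiral a ω (p j) (β j) →
      (t, j) ∈ (turnSolution a ω e p β).dom ∧
        φ.val t j = (turnSolution a ω e p β).val t j := by
    intro j t hle hd hd' hval
    obtain ⟨h1, h2, h3⟩ := flows_of_isSolution hφ hle hd hd'
    have heq : ∀ u ∈ Icc (turnTime ω β j) t, φ.val u j =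
        (e * (-1) ^ j) • spiral a ω (p j) (β j - ω * (u - turnTime ω β j)) :=
      fun u hu => eq_spiral_of_free_motion h hle h1 h2 hval hu
    refine ⟨(mem_dom_iff hω).2 ⟨hle, ?_⟩, heq t (right_mem_Icc.2 hle)⟩
    exact duration_le_of_mem_flowSet h (sign_mul_pow he j) (hs.pos j) (hs.phase_nonneg j) heq h3
  induction j with
  | zero =>
    intro t ht
    have ht0 : turnTime ω β 0 = 0 := by simp [turnTime]
    apply flow 0 t _ _ ht
    · rw [ht0, h0]; simp
    · rw [ht0]; exact hφ.domain.1 _ ht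
    · rw [ht0]; exact hφ.zero_mem
  | succ j ih =>
    intro t ht
    obtain ⟨s, hst, h1, h2⟩ := hφ.domain.exists_jump ht
    obtain ⟨h3, h4⟩ := ih s h1
    obtain ⟨hD, hG⟩ := hφ.jump s j h1 h2
    rw [h4] at hD hG
    -- An arc meets `D` only at its end, so the jump time is forced.
    obtain rfl := hs.val_mem_jumpSet hω he h3 hD
    refine flow (j + 1) t hst h2 ht ?_
    rw [val_turnTime_succ hω] at hG
    rw [(mem_jumpMap_iff (sign_mul_pow he j) (hs.pos j)).1 hG, (hs.halfTurn j).2.2.2]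
    congr 1; ring

lemma jumps_mem (hs : IsTurnSequence a ω θ p β) (h : Underdamped m c k θ a ω) {e : ℝ}
    (he : e = 1 ∨ e = -1) {φ : HybridTrajectory Plane} (hφ : (system m c k θ).IsSolution φ)
    (h0 : φ.val 0 0 = e • spiral a ω (p 0) (β 0)) (j : ℕ) : ∀ t, (t, j) ∈ φ.dom →
      ∀ i < j, (turnTime ω β (i + 1), i) ∈ φ.dom ∧ (turnTime ω β (i + 1), i + 1) ∈ φ.dom := by
  induction j with
  | zero => intro t _ i hi; omega
  | succ j ih =>
    intro t ht i hi
    obtain ⟨s, -, h1, h2⟩ := hφ.domain.exists_jump ht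
    rcases (Nat.lt_succ_iff.1 hi).eq_or_lt with rfl | hlt
    · have e1 := (hs.solution_eq h he hφ h0 i s h1).1.2
      have e2 := (hs.solution_eq h he hφ h0 (i + 1) s h2).1.1
      obtain rfl : s = turnTime ω β (i + 1) := le_antisymm e1 e2
      exact ⟨h1, h2⟩
    · exact ih s h1 i hlt

/-- Each arc lasts at most `π/ω`, so large hybrid time means many jumps. -/
lemma le_of_le_add (hs : IsTurnSequence a ω θ p β) (hω : 0 < ω) {e t : ℝ} {j n : ℕ}
    (ht : (t, j) ∈ (turnSolution a ω e p β).dom) (hn : n * (Real.pi / ω) + n ≤ t + j) :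
    n ≤ j := by
  by_contra! hlt
  have h1 : t ≤ n * (Real.pi / ω) :=
    ht.2.trans ((hs.monotone_turnTime hω hlt).trans (hs.turnTime_le hω n))
  have h2 : (j : ℝ) < n := by exact_mod_cast hlt
  linarith

lemma dom_subset_of_isComplete (hs : IsTurnSequence a ω θ p β) (h : Underdamped m c k θ a ω)
    {e : ℝ} (he : e = 1 ∨ e = -1) {φ : HybridTrajectory Plane}
    (hφ : (system m c k θ).IsSolution φ) (h0 : φ.val 0 0 = e • spiral a ω (p 0) (β 0))
    (hc : φ.IsComplete) : (turnSolution a ω e p β).dom ⊆ φ.dom := by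
  rintro ⟨t, j⟩ ht
  obtain ⟨⟨s, i⟩, hsi, hN⟩ := hc ((j + 1 : ℕ) * (Real.pi / ω) + (j + 1 : ℕ))
  have hji : j < i := hs.le_of_le_add h.freq_pos (hs.solution_eq h he hφ h0 i s hsi).1 hN
  have hjumps := hs.jumps_mem h he hφ h0 i s hsi
  refine hφ.domain.mem_of_le_of_le ?_ (hjumps j hji).1 ht.1 ht.2
  cases j with
  | zero => simpa [turnTime] using hφ.zero_mem
  | succ j => exact (hjumps j (by omega)).2

lemma abs_sq_sub_sq_le (hs : IsTurnSequence a ω θ p β) (h : Underdamped m c k θ a ω)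
    {p₀ β₀ : ℝ} (hfix : IsHalfTurn a ω θ p₀ p₀ β₀) (j : ℕ) :
    |p j ^ 2 - p₀ ^ 2| ≤ Real.exp (-(a / ω * Real.pi)) ^ j * |p 0 ^ 2 - p₀ ^ 2| := by
  induction j with
  | zero => simp
  | succ j ih =>
    refine ((hs.halfTurn j).abs_sq_sub_sq_le h.decay_pos h.freq_pos (hs.pos j).le hfix.1.le
      hfix).trans ?_
    rw [pow_succ' (Real.exp _), mul_assoc]
    gcongr

end IsTurnSequence

lemma contraction_factor_lt_one (h : Underdamped m c k θ a ω) :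
    Real.exp (-(a / ω * Real.pi)) < 1 := Real.exp_lt_one_iff.2 (by
  have := h.decay_pos
  have := h.freq_pos
  have := Real.pi_pos
  have : 0 < a / ω * Real.pi := by positivity
  linarith)

lemma IsTurnSequence.abs_sq_sub_sq_le_initial {p β : ℕ → ℝ} (hs : IsTurnSequence a ω θ p β)
    (h : Underdamped m c k θ a ω) {p₀ β₀ : ℝ} (hfix : IsHalfTurn a ω θ p₀ p₀ β₀) (j : ℕ) :
    |p j ^ 2 - p₀ ^ 2| ≤ |p 0 ^ 2 - p₀ ^ 2| :=
  (hs.abs_sq_sub_sq_le h hfix j).trans (mul_le_of_le_one_left (abs_nonneg _)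
    (pow_le_one₀ (Real.exp_pos _).le (contraction_factor_lt_one h).le))

end ResetOscillator

/-! ### Stability, attraction and the basin. -/

namespace ResetOscillator

variable {m c k θ a ω : ℝ}

lemma infDist_turnSolution (h : Underdamped m c k θ a ω) {p β : ℕ → ℝ} {e t : ℝ} {j : ℕ}
    (he : e = 1 ∨ e = -1) :
    Metric.infDist ((turnSolution a ω e p β).val t j) (attractor m c k θ) =
      Metric.infDist (spiral a ω (p j) (β j - ω * (t - turnTime ω β j))) (attractor m c k θ) :=
  infDist_smul_attractor h (sign_mul_pow he j) _

lemma isStable_attractor (h : Underdamped m c k θ a ω) :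
    (system m c k θ).IsStable (attractor m c k θ) := by
  intro ε hε
  have hω := h.freq_pos
  obtain ⟨p₀, β₀, hfix⟩ := exists_isHalfTurn_fixed h.decay_pos hω h.threshold_pos
  obtain ⟨η, hη, hη'⟩ := exists_infDist_le_of_abs_sq_sub_le h hfix hε
  obtain ⟨δ, hδ, hδ'⟩ := exists_abs_sq_sub_le_of_infDist_le h hfix hη
  have hd0 := infDist_zero_attractor_pos h
  refine ⟨min δ (Metric.infDist 0 (attractor m c k θ) / 2), by positivity, ?_⟩
  rintro φ hφ hle ⟨t, j⟩ ht
  have hne : φ.val 0 0 ≠ 0 := by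
    intro e
    rw [e] at hle
    linarith [hle.trans (min_le_right _ _)]
  obtain ⟨e, p, β, he, hs, h0⟩ :=
    exists_isTurnSequence h (solution_initial_mem_flowSet hφ) hne
  rw [h0, infDist_smul_attractor h he] at hle
  have h1 := hδ' _ _ hs.pos_zero hs.phase_nonneg_zero hs.phase_lt_pi_zero hs.mem_zero
    (hle.trans (min_le_left _ _))
  obtain ⟨h2, h3⟩ := hs.solution_eq h he hφ h0 j t ht
  obtain ⟨h4, h5⟩ := IsTurnSequence.phase_bounds hω h2
  simp only
  rw [h3, infDist_turnSolution h he]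
  exact hη' _ _ (hs.pos j) h4 (h5.trans_lt (hs.phase_lt_pi j)) (hs.spiral_mem hω h2)
    ((hs.abs_sq_sub_sq_le_initial h hfix j).trans h1)

lemma isBounded_image (h : Underdamped m c k θ a ω) {φ : HybridTrajectory Plane}
    (hφ : (system m c k θ).IsSolution φ) {e : ℝ} {p β : ℕ → ℝ} (he : e = 1 ∨ e = -1)
    (hs : IsTurnSequence a ω θ p β) (h0 : φ.val 0 0 = e • spiral a ω (p 0) (β 0)) :
    Bornology.IsBounded φ.image := by
  have hω := h.freq_pos
  obtain ⟨p₀, β₀, hfix⟩ := exists_isHalfTurn_fixed h.decay_pos hω h.threshold_pos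
  -- The contraction gives `p j ^ 2 ≤ M - 1`, and `p j ≤ 1 + p j ^ 2`.
  set M := 1 + (p₀ ^ 2 + |p 0 ^ 2 - p₀ ^ 2|) with hM
  have hcomp : IsCompact ((fun q : ℝ × ℝ => spiral a ω q.1 q.2) ''
      (Icc 0 M ×ˢ Icc 0 Real.pi)) :=
    (isCompact_Icc.prod isCompact_Icc).image continuous_spiral
  obtain ⟨R, hR⟩ := hcomp.isBounded.exists_norm_le
  refine isBounded_iff_forall_norm_le.2 ⟨R, ?_⟩
  rintro _ ⟨⟨t, j⟩, ht, rfl⟩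
  obtain ⟨h2, h3⟩ := hs.solution_eq h he hφ h0 j t ht
  obtain ⟨h4, h5⟩ := IsTurnSequence.phase_bounds hω h2
  have hnorm : ‖e * (-1) ^ j‖ = 1 := by
    rcases sign_mul_pow he j with h6 | h6 <;> simp [h6]
  simp only
  rw [h3]
  simp only [turnSolution, norm_smul, hnorm, one_mul]
  refine hR _ ⟨(p j, β j - ω * (t - turnTime ω β j)), ⟨⟨(hs.pos j).le, ?_⟩, h4,
    h5.trans (hs.phase_lt_pi j).le⟩, rfl⟩
  have h7 := (le_abs_self _).trans (hs.abs_sq_sub_sq_le_initial h hfix j)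
  simp only
  nlinarith [sq_nonneg (p j - 1)]

lemma convergesTo_attractor (h : Underdamped m c k θ a ω) {φ : HybridTrajectory Plane}
    (hφ : (system m c k θ).IsSolution φ) {e : ℝ} {p β : ℕ → ℝ} (he : e = 1 ∨ e = -1)
    (hs : IsTurnSequence a ω θ p β) (h0 : φ.val 0 0 = e • spiral a ω (p 0) (β 0)) :
    HybridSystem.ConvergesTo φ (attractor m c k θ) := by
  intro ε hε
  have hω := h.freq_pos
  obtain ⟨p₀, β₀, hfix⟩ := exists_isHalfTurn_fixed h.decay_pos hω h.threshold_pos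
  obtain ⟨η, hη, hη'⟩ := exists_infDist_le_of_abs_sq_sub_le h hfix hε
  have hlim := (tendsto_pow_atTop_nhds_zero_of_lt_one (Real.exp_pos _).le
    (contraction_factor_lt_one h)).mul_const |p 0 ^ 2 - p₀ ^ 2|
  rw [zero_mul] at hlim
  obtain ⟨n, hn⟩ := eventually_atTop.1 (hlim.eventually (ge_mem_nhds hη))
  refine ⟨n * (Real.pi / ω) + n, ?_⟩
  rintro ⟨t, j⟩ ht hN
  obtain ⟨h2, h3⟩ := hs.solution_eq h he hφ h0 j t ht
  obtain ⟨h4, h5⟩ := IsTurnSequence.phase_bounds hω h2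
  simp only
  rw [h3, infDist_turnSolution h he]
  exact hη' _ _ (hs.pos j) h4 (h5.trans_lt (hs.phase_lt_pi j)) (hs.spiral_mem hω h2)
    ((hs.abs_sq_sub_sq_le h hfix j).trans (hn j (hs.le_of_le_add hω h2 hN)))

lemma isAttractedTo_of_ne_zero (h : Underdamped m c k θ a ω) {ξ : Plane} (hξ : ξ ≠ 0) :
    (system m c k θ).IsAttractedTo (attractor m c k θ) ξ := by
  rintro φ hφ rfl
  obtain ⟨e, p, β, he, hs, h0⟩ :=
    exists_isTurnSequence h (solution_initial_mem_flowSet hφ) hξ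
  refine ⟨isBounded_image h hφ he hs h0, fun hmax => ?_,
    fun _ => convergesTo_attractor h hφ he hs h0⟩
  have hsub : φ.dom ⊆ (turnSolution a ω e p β).dom := fun q hq =>
    (hs.solution_eq h he hφ h0 q.2 q.1 hq).1
  by_contra hnc
  -- An incomplete solution is a proper restriction of the complete one, hence not maximal.
  refine hmax.2 ⟨turnSolution a ω e p β, hs.isSolution h he, hsub.ssubset_of_ne fun heq => hnc ?_,
    fun q hq => (hs.solution_eq h he hφ h0 q.2 q.1 hq).2.symm⟩
  have := hs.isComplete h.freq_pos e
  rwa [HybridTrajectory.IsComplete, ← heq] at this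

/-- The solution that rests at the origin. -/
noncomputable def restSolution : HybridTrajectory Plane where
  dom := {q | 0 ≤ q.1 ∧ q.2 = 0}
  val _ _ := 0

lemma restSolution_isSolution : (system m c k θ).IsSolution restSolution where
  domain := by
    refine ⟨fun q hq => hq.1, ?_⟩
    rintro ⟨T, J⟩ ⟨hT, rfl⟩
    refine ⟨1, fun j => if j = 0 then 0 else T, by simp, fun j hj => ?_, ?_⟩
    · obtain rfl : j = 0 := by omega
      simpa using hT
    · ext ⟨u, i⟩
      simp only [restSolution, mem_inter_iff, mem_ofPred_eq, mem_prod, mem_Icc, mem_Iic]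
      constructor
      · rintro ⟨⟨h1, rfl⟩, ⟨-, h3⟩, -⟩
        exact ⟨one_pos, by simpa using h1, by simpa using h3⟩
      · rintro ⟨h1, h2, h3⟩
        obtain rfl : i = 0 := by omega
        simp only [if_true] at h2
        exact ⟨⟨h2, rfl⟩, ⟨h2, by simpa using h3⟩, le_rfl⟩
  zero_mem := ⟨le_rfl, rfl⟩
  absCont j s t _ _ :=
    (contDiff_const (c := (0 : Plane))).absolutelyContinuousOnInterval s t
  init := Or.inr rfl
  flow_mem j t _ := mem_flowSet_of_position_eq_zero rfl
  flow_deriv j := Eventually.of_forall fun t _ => by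
    refine ⟨_, rfl, ?_⟩
    have : vectorField m c k 0 = 0 := by apply plane_ext <;> simp [vectorField]
    simpa [restSolution, this] using hasDerivAt_const t (0 : Plane)
  jump t j _ h2 := absurd h2.2 (Nat.succ_ne_zero j)

lemma not_isAttractedTo_zero (h : Underdamped m c k θ a ω) :
    ¬ (system m c k θ).IsAttractedTo (attractor m c k θ) 0 := by
  intro hatt
  have hc : restSolution.IsComplete := fun N =>
    ⟨(max N 0, 0), ⟨le_max_right _ _, rfl⟩, by simp⟩
  have hd := infDist_zero_attractor_pos h
  obtain ⟨N, hN⟩ := (hatt restSolution restSolution_isSolution rfl).2.2 hc _ (half_pos hd)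
  have := hN (max N 0, 0) ⟨le_max_right _ _, rfl⟩ (by simp)
  simp only [restSolution] at this
  linarith

lemma basinOfAttraction_attractor (h : Underdamped m c k θ a ω) :
    (system m c k θ).basinOfAttraction (attractor m c k θ) = {x | x ≠ 0} := by
  ext x
  refine ⟨?_, fun hx => isAttractedTo_of_ne_zero h hx⟩
  rintro hx rfl
  exact not_isAttractedTo_zero h hx

lemma isAsymptoticallyStable_attractor (h : Underdamped m c k θ a ω) :
    (system m c k θ).IsAsymptoticallyStable (attractor m c k θ) := by
  have hd := infDist_zero_attractor_pos h
  refine ⟨isStable_attractor h, _, half_pos hd, fun ξ hξ => isAttractedTo_of_ne_zero h ?_⟩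
  rintro rfl
  linarith

/-! ### Periodic trajectories. -/

/-- A solution from the origin either never jumps and rests there, or jumps away and is nonzero ever
after. In the second case a period with jumps would bring it back to the origin, and one without
jumps would contradict the decay. -/
lemma initial_ne_zero_of_periodic (h : Underdamped m c k θ a ω) {φ : HybridTrajectory Plane}
    (hφ : (system m c k θ).IsNontrivialPeriodicTrajectory φ) : φ.val 0 0 ≠ 0 := by
  intro h0
  obtain ⟨⟨hsol, -, T, J, hTJ, hper⟩, hnt⟩ := hφ
  by_cases hj : ∃ t j, (t, j + 1) ∈ φ.dom
  · obtain ⟨t, j, ht⟩ := hj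
    cases J with
    | zero =>
      have hT : 0 < T := by
        rcases hTJ with h1 | h1
        · exact absurd h1.2 (lt_irrefl 0)
        · exact h1.1
      obtain ⟨h1, h2⟩ := hper t (j + 1) ht
      exact solution_ne_zero_of_jumped h hsol ht
        (solution_eq_zero_of_recurrence h hsol (by linarith) ht h1 h2)
    | succ J =>
      obtain ⟨h1, h2⟩ := hper 0 0 hsol.zero_mem
      rw [zero_add] at h1 h2
      rw [zero_add] at h1 h2
      exact solution_ne_zero_of_jumped h hsol h1 (h2 ▸ h0)
  · push Not at hj
    refine (Set.not_nontrivial_singleton (x := (0 : Plane))) (hnt.mono ?_)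
    rintro _ ⟨⟨t, j⟩, ht, rfl⟩
    cases j with
    | zero => exact (solution_eq_zero_iff h hsol (hsol.domain.1 _ ht) hsol.zero_mem ht).2 h0
    | succ j => exact absurd ht (hj t j)

lemma amplitude_eq_of_smul_eq {p p' β β' e e' : ℝ} (hω : 0 < ω) (he : e = 1 ∨ e = -1)
    (he' : e' = 1 ∨ e' = -1) (hp : 0 < p) (hp' : 0 < p') (h0 : 0 ≤ β) (hπ : β < Real.pi)
    (h0' : 0 ≤ β') (hπ' : β' < Real.pi) (hR : spiral a ω p β ∈ rightSet θ)
    (hR' : spiral a ω p' β' ∈ rightSet θ) (heq : e • spiral a ω p β = e' • spiral a ω p' β') :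
    p = p' := by
  rcases he with rfl | rfl <;> rcases he' with rfl | rfl <;>
    simp only [one_smul, neg_smul, neg_inj] at heq
  · exact (spiral_inj hω hp hp' h0 hπ h0' hπ' heq).1
  · exact absurd (heq ▸ hR) (neg_notMem_rightSet hR')
  · exact absurd (heq ▸ hR') (neg_notMem_rightSet hR)
  · exact (spiral_inj hω hp hp' h0 hπ h0' hπ' heq).1

lemma image_eq_attractor_of_complete (h : Underdamped m c k θ a ω) {p₀ β₀ : ℝ}
    (hfix : IsHalfTurn a ω θ p₀ p₀ β₀) {φ : HybridTrajectory Plane}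
    (hφ : (system m c k θ).IsSolution φ) (hc : φ.IsComplete) {e : ℝ} {p β : ℕ → ℝ}
    (he : e = 1 ∨ e = -1) (hs : IsTurnSequence a ω θ p β)
    (h0 : φ.val 0 0 = e • spiral a ω (p 0) (β 0)) (hp : p 0 = p₀) :
    φ.image = attractor m c k θ := by
  have hω := h.freq_pos
  have hpj : ∀ j, p j = p₀ := by
    intro j
    have h1 := hs.abs_sq_sub_sq_le_initial h hfix j
    rw [hp, sub_self, abs_zero] at h1
    have h2 := abs_eq_zero.1 (le_antisymm h1 (abs_nonneg _))
    exact (pow_left_inj₀ (hs.pos j).le hfix.1.le two_ne_zero).1 (by linarith)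
  have hβj : ∀ j, β (j + 1) = β₀ := by
    intro j
    obtain ⟨h1, h2, h3, h4⟩ := hs.halfTurn j
    rw [hpj j, hpj (j + 1)] at h4
    exact (spiral_inj hω hfix.1 hfix.1 h2.le h3 hfix.2.1.le hfix.2.2.1
      (h4.trans hfix.2.2.2.symm)).2
  have hdom := hs.dom_subset_of_isComplete h he hφ h0 hc
  apply Subset.antisymm
  · rintro _ ⟨⟨t, j⟩, ht, rfl⟩
    obtain ⟨h2, h3⟩ := hs.solution_eq h he hφ h0 j t ht
    obtain ⟨h4, h5⟩ := IsTurnSequence.phase_bounds hω h2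
    have hmem := (spiral_mem_attractor_iff h hfix (hs.pos j) h4
      (h5.trans_lt (hs.phase_lt_pi j)) (hs.spiral_mem hω h2)).2 (hpj j)
    simp only
    rw [h3]
    simp only [turnSolution]
    rcases sign_mul_pow he j with h6 | h6
    · rwa [h6, one_smul]
    · rw [h6, neg_one_smul]; exact neg_mem_attractor h hmem
  -- The initial arc may be only part of a half turn; arcs `1` and `2` are full and of opposite
  -- sign, so together they cover `A`.
  · have arc : ∀ j, ∀ b ∈ Icc 0 β₀, (e * (-1) ^ (j + 1)) • spiral a ω p₀ b ∈ φ.image := by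
      intro j b hb
      have e1 : ω * (turnTime ω β (j + 1) + (β₀ - b) / ω - turnTime ω β (j + 1)) = β₀ - b := by
        field_simp; ring
      have hd : (turnTime ω β (j + 1) + (β₀ - b) / ω, j + 1) ∈
          (turnSolution a ω e p β).dom := by
        rw [IsTurnSequence.mem_dom_iff hω, e1, hβj]
        exact ⟨le_add_of_nonneg_right (div_nonneg (by linarith [hb.2]) hω.le), by linarith [hb.1]⟩
      refine ⟨_, hdom hd, ?_⟩
      simp only
      rw [(hs.solution_eq h he hφ h0 _ _ (hdom hd)).2]
      simp only [turnSolution, e1, hβj, hpj, sub_sub_cancel]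
    have both : ∀ b ∈ Icc 0 β₀, spiral a ω p₀ b ∈ φ.image ∧ -spiral a ω p₀ b ∈ φ.image := by
      intro b hb
      have h1 := arc 0 b hb
      have h2 := arc 1 b hb
      rcases he with rfl | rfl
      · exact ⟨by simpa using h2, by simpa using h1⟩
      · exact ⟨by simpa using h1, by simpa using h2⟩
    rw [attractor_eq h hfix]
    rintro x (⟨b, hb, rfl⟩ | ⟨b, hb, rfl⟩)
    · exact (both b hb).1
    · exact (both b hb).2

lemma image_eq_attractor_of_periodic (h : Underdamped m c k θ a ω) {φ : HybridTrajectory Plane}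
    (hφ : (system m c k θ).IsNontrivialPeriodicTrajectory φ) :
    φ.image = attractor m c k θ := by
  have hω := h.freq_pos
  have hne := initial_ne_zero_of_periodic h hφ
  obtain ⟨⟨hsol, hc, T, J, hTJ, hper⟩, -⟩ := hφ
  obtain ⟨p₀, β₀, hfix⟩ := exists_isHalfTurn_fixed h.decay_pos hω h.threshold_pos
  obtain ⟨e, p, β, he, hs, h0⟩ :=
    exists_isTurnSequence h (solution_initial_mem_flowSet hsol) hne
  refine image_eq_attractor_of_complete h hfix hsol hc he hs h0 ?_
  obtain ⟨h1, h2⟩ := hper 0 0 hsol.zero_mem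
  rw [zero_add, zero_add] at h1 h2
  have hJ : J ≠ 0 := by
    rintro rfl
    have hT : 0 < T := by
      rcases hTJ with h3 | h3
      · exact absurd h3.2 (lt_irrefl 0)
      · exact h3.1
    exact hne (solution_eq_zero_of_recurrence h hsol hT hsol.zero_mem h1 h2)
  obtain ⟨h3, h4⟩ := hs.solution_eq h he hsol h0 J T h1
  obtain ⟨h5, h6⟩ := IsTurnSequence.phase_bounds hω h3
  rw [h4, h0] at h2
  have hamp : p 0 = p J := amplitude_eq_of_smul_eq hω he (sign_mul_pow he J) hs.pos_zero
    (hs.pos J) hs.phase_nonneg_zero hs.phase_lt_pi_zero h5 (h6.trans_lt (hs.phase_lt_pi J))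
    hs.mem_zero (hs.spiral_mem hω h3) h2
  -- After `J ≥ 1` jumps the amplitude is the same, yet its error has shrunk by a factor below `1`:
  -- the error is zero.
  have hle := hs.abs_sq_sub_sq_le h hfix J
  rw [← hamp] at hle
  have hq : Real.exp (-(a / ω * Real.pi)) ^ J < 1 :=
    pow_lt_one₀ (Real.exp_pos _).le (contraction_factor_lt_one h) hJ
  have habs : |p 0 ^ 2 - p₀ ^ 2| = 0 := by
    have := abs_nonneg (p 0 ^ 2 - p₀ ^ 2)
    nlinarith
  exact (pow_left_inj₀ hs.pos_zero.le hfix.1.le two_ne_zero).1 (by linarith [abs_eq_zero.1 habs])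

lemma exists_nontrivial_periodic (h : Underdamped m c k θ a ω) :
    ∃ φ : HybridTrajectory Plane, (system m c k θ).IsNontrivialPeriodicTrajectory φ := by
  have hω := h.freq_pos
  obtain ⟨p₀, β₀, hfix⟩ := exists_isHalfTurn_fixed h.decay_pos hω h.threshold_pos
  have hβ₀ := hfix.2.1
  have hs : IsTurnSequence a ω θ (fun _ => p₀) (fun _ => β₀) :=
    ⟨hfix.1, hfix.2.1.le, hfix.2.2.1, hfix.mem_rightSet hω, fun _ => hfix⟩
  have hsol := hs.isSolution h (e := 1) (Or.inl rfl)
  have hc := hs.isComplete hω 1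
  have himg := image_eq_attractor_of_complete h hfix hsol hc (Or.inl rfl) hs
    (by simp [turnSolution, turnTime]) rfl
  -- One half turn only returns the negative of the state, so the period has two jumps.
  refine ⟨turnSolution a ω 1 (fun _ => p₀) (fun _ => β₀), ⟨hsol, hc, 2 * (β₀ / ω), 2,
    Or.inl ⟨by positivity, two_pos⟩, ?_⟩, ?_⟩
  · intro t j ht
    have e1 : turnTime ω (fun _ => β₀) (j + 2) = turnTime ω (fun _ => β₀) j + 2 * (β₀ / ω) := by
      rw [IsTurnSequence.turnTime_succ, IsTurnSequence.turnTime_succ]; ring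
    rw [IsTurnSequence.mem_dom_iff hω] at ht
    refine ⟨?_, ?_⟩
    · rw [IsTurnSequence.mem_dom_iff hω, e1, add_sub_add_right_eq_sub]
      exact ⟨by linarith [ht.1], ht.2⟩
    · simp only [turnSolution, e1, add_sub_add_right_eq_sub, pow_add, neg_one_sq, mul_one]
  · rw [himg, attractor_eq h hfix]
    refine ⟨spiral a ω p₀ 0, Or.inl ⟨0, ⟨le_rfl, hβ₀.le⟩, rfl⟩, spiral a ω p₀ β₀,
      Or.inl ⟨β₀, ⟨hβ₀.le, le_rfl⟩, rfl⟩, fun heq => ?_⟩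
    exact hβ₀.ne (spiral_inj hω hfix.1 hfix.1 le_rfl Real.pi_pos hβ₀.le hfix.2.2.1 heq).2

end ResetOscillator

theorem theorem2 (m c k θ : ℝ) (hθ : 0 < θ) (hm : 0 < m) (hc : 0 < c) (hk : 0 < k)
    (hroots : (c / (2 * m)) ^ 2 - k / m < 0) :
    -- the backward and forward points, hence `T_b` and `T_f`, are well defined on the flow set
    (∀ x ∈ ResetOscillator.flowSet θ,
      (∃! y, ResetOscillator.IsBackwardPoint m c k θ x y) ∧
      (∃! y, ResetOscillator.IsForwardPoint m c k θ x y)) ∧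
    (ResetOscillator.attractor m c k θ).Nonempty ∧
    IsCompact (ResetOscillator.attractor m c k θ) ∧
    -- nontrivial periodic trajectories exist, and each of them has image `A`
    {S : Set ResetOscillator.Plane | ∃ φ : HybridTrajectory ResetOscillator.Plane,
      (ResetOscillator.system m c k θ).IsNontrivialPeriodicTrajectory φ ∧ φ.image = S} =
        {ResetOscillator.attractor m c k θ} ∧
    (ResetOscillator.system m c k θ).IsAsymptoticallyStable
      (ResetOscillator.attractor m c k θ) ∧
    (ResetOscillator.system m c k θ).basinOfAttraction
      (ResetOscillator.attractor m c k θ) = {x | x ≠ 0} := by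
  obtain ⟨a, ω, h⟩ := ResetOscillator.exists_underdamped hθ hm hc hroots
  refine ⟨fun x hx => ResetOscillator.existsUnique_points h hx,
    ResetOscillator.attractor_nonempty h, ResetOscillator.isCompact_attractor h, ?_,
    ResetOscillator.isAsymptoticallyStable_attractor h,
    ResetOscillator.basinOfAttraction_attractor h⟩
  ext S
  constructor
  · rintro ⟨φ, hφ, rfl⟩
    exact ResetOscillator.image_eq_attractor_of_periodic h hφ
  · rintro rfl
    obtain ⟨φ, hφ⟩ := ResetOscillator.exists_nontrivial_periodic h
    exact ⟨φ, hφ, ResetOscillator.image_eq_attractor_of_periodic h hφ⟩
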